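/- Let $V\subset\mathbb Z^d$ be finite, $\lambda,\kappa\ge 0$, $\gamma>0$. Let $p$ be a symmetric probability distribution on $\mathbb Z^d$, $p(z)=p(-z)$, with $\sum_z e^{\langle\alpha,z\rangle}p(z)<\infty$ for all $\alpha\in\mathbb R^d$, and let $\pi(v,v')\ge 0$ ($v\ne v'$ in $V$) be the rates of an irreducible continuous-time Markov chain on $V$, with generator $Af(v)=\sum_{v'\in V}\pi(v,v')(f(v')-f(v))$. Let $\{(X_t,v_t):t\ge 0\}$ be the Markov process on $\mathbb Z^d\times V$ with generator $$Lf(x,v)=\lambda\,(f(x+v,v)-f(x,v))+\kappa\sum_{z}p(z)(f(x+z,v)-f(x,v))+\gamma\sum_{v'\in V}\pi(v,v')(f(x,v')-f(x,v)),$$ started from $X_0=0$ and an arbitrary (random) initial velocity. Put $\Gamma(\alpha)=\sum_z p(z)(e^{\langle\alpha,z\rangle}-1)$, $\psi_\alpha(v)=\kappa\Gamma(\alpha)+\lambda(e^{\langle\alpha,v\rangle}-1)$, and $M(\alpha)=\gamma A+\mathrm{diag}(\psi_\alpha)$, where $A$ also denotes the matrix of the generator $A$: $A_{v,v'}=\pi(v,v')$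 for $v\neq v'$ and $A_{v,v}=-\sum_{v'\ne v}\pi(v,v')$. Let $\mathcal P(V)$ be the set of probability measures on $V$ and, for $\mu\in\mathcal P(V)$, let $I_A(\mu)=-\inf_{f>0}\sum_v\mu(v)\frac{Af(v)}{f(v)}$. Then for every $\alpha\in\mathbb R^d$ one has $\mathbb E\,e^{\langle\alpha,X_t\rangle}<\infty$ for all $t\ge 0$, and the limit $$F(\alpha)=\lim_{t\to\infty}\frac1t\log\mathbb E\, e^{\langle\alpha,X_t\rangle}\in\mathbb R$$ exists. It is the largest eigenvalue of $M(\alpha)$ (that is, $F(\alpha)$ is an eigenvalue of $M(\alpha)$, and every complex eigenvalue of $M(\alpha)$ has real part at most $F(\alpha)$), and $$F(\alpha)=\sup_{\mu\in\mathcal P(V)}\Big(\sum_v\psi_\alpha(v)\mu(v)-\gamma I_A(\mu)\Big)=\kappa\Gamma(\alpha)+\sup_{\mu\in\mathcal P(V)}\Big(\sum_v\lambda(e^{\langle\alpha,v\rangle}-1)\mu(v)-\gamma I_A(\mu)\Big).$$ If moreover $\pi(v,v')=\pi(v',v)$ for all $v,v'$, then $$F(\alpha)=\sup_{\mu\in\mathcal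 P(V)}\Big(\sum_v\psi_\alpha(v)\mu(v)+\gamma\sum_{v,v'}\sqrt{\mu(v)}\sqrt{\mu(v')}\,A_{v,v'}\Big).$$ Finally, as $t\to\infty$, $X_t/t$ satisfies the large deviation principle on $\mathbb R^d$ with speed $t$ and good rate function $I(x)=\sup_{\alpha\in\mathbb R^d}(\langle\alpha,x\rangle-F(\alpha))\in[0,\infty]$: $I$ is lower semicontinuous with compact sublevel sets, and $$\limsup_{t\to\infty}\frac1t\log\mathbb P\Big(\frac{X_t}{t}\in B\Big)\le-\inf_{x\in B}I(x)\ \ (B\text{ closed}),\qquad \liminf_{t\to\infty}\frac1t\log\mathbb P\Big(\frac{X_t}{t}\in G\Big)\ge-\inf_{x\in G}I(x)\ \ (G\text{ open}).$$ -/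

import Mathlib

open MeasureTheory Filter Topology
open scoped NNReal BoundedContinuousFunction

noncomputable section

/-- The lattice `ℤ^d`. -/
abbrev IntLattice (d : ℕ) : Type := Fin d → ℤ

/-- A point of `ℤ^d`, seen as a point of Euclidean space `ℝ^d`. -/
def latticeVec {d : ℕ} (x : IntLattice d) : EuclideanSpace ℝ (Fin d) :=
  WithLp.toLp 2 (fun i => (x i : ℝ))

/-- The semigroup `exp (t L)` of a bounded operator `L` on a real normed space. -/
def expSemigroup {B : Type*} [NormedAddCommGroup B] [NormedSpace ℝ B] (L : B →L[ℝ] B) (t : ℝ≥0) :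
    B →L[ℝ] B :=
  NormedSpace.exp ((t : ℝ) • L)

/-- The parameters of the general lattice active particle on `ℤ^d`, with their standing
assumptions: a finite velocity set `V`, the rates `lam` of transport, `kap` of diffusion and `gam`
of flipping, a symmetric probability distribution `p` on `ℤ^d` with all exponential moments, and
velocity flip rates `flip v v'` (`v ≠ v'`; the diagonal plays no role) which generate an irreducible
continuous-time Markov chain on `V`. -/
structure ActiveParticleModel (d : ℕ) where
  V : Finset (IntLattice d)
  lam : ℝ
  kap : ℝ
  gam : ℝ
  p : IntLattice d → ℝ
  flip : V → V → ℝ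
  lam_nonneg : 0 ≤ lam
  kap_nonneg : 0 ≤ kap
  gam_pos : 0 < gam
  p_nonneg : ∀ z, 0 ≤ p z
  p_hasSum : HasSum p 1
  p_symm : ∀ z, p (-z) = p z
  p_exp : ∀ α : EuclideanSpace ℝ (Fin d),
    Summable fun z : IntLattice d => Real.exp (inner ℝ α (latticeVec z)) * p z
  flip_nonneg : ∀ v v', v ≠ v' → 0 ≤ flip v v'
  flip_irreducible : ∀ v v', Relation.ReflTransGen (fun a b => a ≠ b ∧ 0 < flip a b) v v'

namespace ActiveParticleModel

variable {d : ℕ} (m : ActiveParticleModel d)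

/-- The state space of the particle: pairs of a position and a velocity. -/
abbrev State : Type := IntLattice d × m.V

/-- The transport part `L_t` of the generator. -/
def transport (f : m.State → ℝ) (s : m.State) : ℝ :=
  f (s.1 + (s.2 : IntLattice d), s.2) - f s

/-- The diffusion part `L_d` of the generator. -/
def diffusion (f : m.State → ℝ) (s : m.State) : ℝ :=
  ∑' z : IntLattice d, m.p z * (f (s.1 + z, s.2) - f s)

/-- The generator `A` of the velocity flip process, on functions on `V`. -/
def flipGen (f : m.V → ℝ) (v : m.V) : ℝ :=
  ∑ v' : m.V, m.flip v v' * (f v' - f v)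

/-- The expression `L f = lam * L_t f + kap * L_d f + gam * L_f f`. -/
def generatorFun (f : m.State → ℝ) (s : m.State) : ℝ :=
  m.lam * m.transport f s + m.kap * m.diffusion f s +
    m.gam * m.flipGen (fun v => f (s.1, v)) s.2

theorem abs_sub_le_two_norm (f : m.State →ᵇ ℝ) (s s' : m.State) : |f s - f s'| ≤ 2 * ‖f‖ := by
  have := f.dist_le_two_norm s s'
  rwa [Real.dist_eq] at this

theorem summable_diffusion (f : m.State →ᵇ ℝ) (s : m.State) :
    Summable fun z : IntLattice d => m.p z * (f (s.1 + z, s.2) - f s) := by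
  refine Summable.of_norm_bounded (m.p_hasSum.summable.mul_right (2 * ‖f‖)) fun z => ?_
  rw [Real.norm_eq_abs, abs_mul, abs_of_nonneg (m.p_nonneg z)]
  exact mul_le_mul_of_nonneg_left (m.abs_sub_le_two_norm f _ _) (m.p_nonneg z)

theorem abs_diffusion_le (f : m.State →ᵇ ℝ) (s : m.State) : |m.diffusion f s| ≤ 2 * ‖f‖ := by
  have h := m.p_hasSum.mul_right (2 * ‖f‖)
  rw [one_mul] at h
  refine tsum_of_norm_bounded (f := fun z => m.p z * (f (s.1 + z, s.2) - f s)) h fun z => ?_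
  rw [Real.norm_eq_abs, abs_mul, abs_of_nonneg (m.p_nonneg z)]
  exact mul_le_mul_of_nonneg_left (m.abs_sub_le_two_norm f _ _) (m.p_nonneg z)

theorem abs_generatorFun_le (f : m.State →ᵇ ℝ) (s : m.State) :
    |m.generatorFun f s| ≤
      (2 * m.lam + 2 * m.kap + 2 * m.gam * ∑ v : m.V, ∑ v' : m.V, |m.flip v v'|) * ‖f‖ := by
  have h1 : |m.transport f s| ≤ 2 * ‖f‖ := m.abs_sub_le_two_norm f _ _
  have h2 := m.abs_diffusion_le f s
  have h3 : |m.flipGen (fun v => f (s.1, v)) s.2| ≤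
      (∑ v : m.V, ∑ v' : m.V, |m.flip v v'|) * (2 * ‖f‖) := by
    calc |m.flipGen (fun v => f (s.1, v)) s.2|
        ≤ ∑ v' : m.V, |m.flip s.2 v' * (f (s.1, v') - f (s.1, s.2))| :=
          Finset.abs_sum_le_sum_abs _ _
      _ ≤ ∑ v' : m.V, |m.flip s.2 v'| * (2 * ‖f‖) := by
          refine Finset.sum_le_sum fun v' _ => ?_
          rw [abs_mul]
          exact mul_le_mul_of_nonneg_left (m.abs_sub_le_two_norm f _ _) (abs_nonneg _)
      _ = (∑ v' : m.V, |m.flip s.2 v'|) * (2 * ‖f‖) := by rw [Finset.sum_mul]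
      _ ≤ _ := by
          refine mul_le_mul_of_nonneg_right ?_ (by positivity)
          exact Finset.single_le_sum (f := fun v : m.V => ∑ v' : m.V, |m.flip v v'|)
            (fun v _ => Finset.sum_nonneg fun v' _ => abs_nonneg _) (Finset.mem_univ s.2)
  have e1 := mul_le_mul_of_nonneg_left h1 m.lam_nonneg
  have e2 := mul_le_mul_of_nonneg_left h2 m.kap_nonneg
  have e3 := mul_le_mul_of_nonneg_left h3 m.gam_pos.le
  calc |m.generatorFun f s|
      ≤ |m.lam * m.transport f s| + |m.kap * m.diffusion f s| +
          |m.gam * m.flipGen (fun v => f (s.1, v)) s.2| := abs_add_three _ _ _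
    _ = m.lam * |m.transport f s| + m.kap * |m.diffusion f s| +
          m.gam * |m.flipGen (fun v => f (s.1, v)) s.2| := by
        rw [abs_mul, abs_mul, abs_mul, abs_of_nonneg m.lam_nonneg, abs_of_nonneg m.kap_nonneg,
          abs_of_pos m.gam_pos]
    _ ≤ _ := by linarith

/-- The generator `L` is a bounded operator on the Banach space of bounded functions on the
(discrete, countable) state space. -/
def generator : (m.State →ᵇ ℝ) →L[ℝ] (m.State →ᵇ ℝ) :=
  LinearMap.mkContinuous
    { toFun := fun f => BoundedContinuousFunction.ofNormedAddCommGroupDiscrete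
        (m.generatorFun f) _ (m.abs_generatorFun_le f)
      map_add' := fun f g => by
        ext s
        have h : m.diffusion (fun s => f s + g s) s = m.diffusion f s + m.diffusion g s := by
          unfold diffusion
          rw [← (m.summable_diffusion f s).tsum_add (m.summable_diffusion g s)]
          exact tsum_congr fun z => by ring
        have h' : m.flipGen (fun v => f (s.1, v) + g (s.1, v)) s.2 =
            m.flipGen (fun v => f (s.1, v)) s.2 + m.flipGen (fun v => g (s.1, v)) s.2 := by
          unfold flipGen
          rw [← Finset.sum_add_distrib]
          exact Finset.sum_congr rfl fun z _ => by ring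
        change m.generatorFun (fun s => f s + g s) s = m.generatorFun f s + m.generatorFun g s
        simp only [generatorFun, transport, h, h']
        ring
      map_smul' := fun c f => by
        ext s
        have h : m.diffusion (fun s => c * f s) s = c * m.diffusion f s := by
          unfold diffusion
          rw [← tsum_mul_left]
          exact tsum_congr fun z => by ring
        have h' : m.flipGen (fun v => c * f (s.1, v)) s.2 =
            c * m.flipGen (fun v => f (s.1, v)) s.2 := by
          unfold flipGen
          rw [Finset.mul_sum]
          exact Finset.sum_congr rfl fun z _ => by ring
        change m.generatorFun (fun s => c * f s) s = c * m.generatorFun f s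
        simp only [generatorFun, transport, h, h']
        ring }
    (2 * m.lam + 2 * m.kap + 2 * m.gam * ∑ v : m.V, ∑ v' : m.V, |m.flip v v'|)
    (fun f => by
      have h0 : 0 ≤ 2 * m.lam + 2 * m.kap + 2 * m.gam * ∑ v : m.V, ∑ v' : m.V, |m.flip v v'| := by
        have := m.lam_nonneg
        have := m.kap_nonneg
        have := m.gam_pos
        positivity
      exact (BoundedContinuousFunction.norm_le (by positivity)).2 (m.abs_generatorFun_le f))

theorem generator_apply (f : m.State →ᵇ ℝ) (s : m.State) :
    m.generator f s = m.generatorFun f s := rfl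

/-- The transition semigroup `exp (t L)` on bounded functions. -/
def semigroup (t : ℝ≥0) : (m.State →ᵇ ℝ) →L[ℝ] (m.State →ᵇ ℝ) :=
  expSemigroup m.generator t

/-- `(X, v)` is, on the probability space `(Ω, P)`, a Markov process (with respect to its natural
filtration) whose generator is `L`, started with `X_0 = 0` and an arbitrary random initial
velocity. -/
structure IsActiveParticle {Ω : Type*} [MeasurableSpace Ω] (P : Measure Ω)
    (X : ℝ≥0 → Ω → IntLattice d) (v : ℝ≥0 → Ω → m.V) : Prop where
  measurable_pos : ∀ t, Measurable (X t)
  measurable_vel : ∀ t, Measurable (v t)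
  start : ∀ᵐ ω ∂P, X 0 ω = 0
  markov : ∀ (s t : ℝ≥0) (f : m.State →ᵇ ℝ),
    P[fun ω => f (X (s + t) ω, v (s + t) ω) |
        ⨆ r ∈ Set.Iic s, MeasurableSpace.comap (fun ω => (X r ω, v r ω)) inferInstance]
      =ᵐ[P] fun ω => m.semigroup t f (X s ω, v s ω)

/-- The matrix of the velocity flip generator `A`. -/
def flipMatrix : Matrix m.V m.V ℝ := fun v v' =>
  if v = v' then -∑ w ∈ Finset.univ.erase v, m.flip v w else m.flip v v'

theorem flipMatrix_mulVec (f : m.V → ℝ) : m.flipMatrix.mulVec f = m.flipGen f := by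
  ext v
  simp only [Matrix.mulVec, dotProduct, flipGen]
  rw [← Finset.add_sum_erase _ _ (Finset.mem_univ v),
    ← Finset.add_sum_erase _ (fun v' => m.flip v v' * (f v' - f v)) (Finset.mem_univ v)]
  have h : ∑ x ∈ Finset.univ.erase v, m.flipMatrix v x * f x =
      ∑ x ∈ Finset.univ.erase v, m.flip v x * f x :=
    Finset.sum_congr rfl fun x hx => by
      rw [flipMatrix, if_neg (Finset.ne_of_mem_erase hx).symm]
  rw [h]
  simp only [flipMatrix, if_true, mul_sub, Finset.sum_sub_distrib, Finset.sum_mul, neg_mul]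
  ring

/-- `Γ(α) = ∑_z p(z) (exp ⟨α, z⟩ - 1)`. -/
def jumpCumulant (α : EuclideanSpace ℝ (Fin d)) : ℝ :=
  ∑' z : IntLattice d, m.p z * (Real.exp (inner ℝ α (latticeVec z)) - 1)

/-- `ψ_α(v) = kap * Γ(α) + lam * (exp ⟨α, v⟩ - 1)`. -/
def potential (α : EuclideanSpace ℝ (Fin d)) (v : m.V) : ℝ :=
  m.kap * m.jumpCumulant α + m.lam * (Real.exp (inner ℝ α (latticeVec (v : IntLattice d))) - 1)

/-- `M(α) = gam * A + diag ψ_α`. -/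
def tiltedMatrix (α : EuclideanSpace ℝ (Fin d)) : Matrix m.V m.V ℝ :=
  m.gam • m.flipMatrix + Matrix.diagonal (m.potential α)

/-- The Donsker-Varadhan rate function `I_A(μ) = - inf_{f > 0} ∫ (A f / f) dμ`. The infimum is over
a non-empty set of reals, bounded below by `-∑_v μ(v) ∑_{v' ≠ v} flip v v'` for every
probability vector `μ`. -/
def donskerVaradhan (μ : m.V → ℝ) : ℝ :=
  -⨅ f : {f : m.V → ℝ // ∀ v, 0 < f v}, ∑ v : m.V, (m.flipGen f.1 v / f.1 v) * μ v

theorem bddBelow_donskerVaradhan (μ : m.V → ℝ) (hμ : μ ∈ stdSimplex ℝ m.V) :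
    BddBelow (Set.range fun f : {f : m.V → ℝ // ∀ v, 0 < f v} =>
      ∑ v : m.V, (m.flipGen f.1 v / f.1 v) * μ v) := by
  refine ⟨∑ v : m.V, m.flipMatrix v v * μ v, ?_⟩
  rintro _ ⟨f, rfl⟩
  refine Finset.sum_le_sum fun v _ => mul_le_mul_of_nonneg_right ?_ (hμ.1 v)
  rw [le_div_iff₀ (f.2 v), ← m.flipMatrix_mulVec]
  simp only [Matrix.mulVec, dotProduct]
  rw [← Finset.add_sum_erase _ _ (Finset.mem_univ v)]
  refine le_add_of_nonneg_right (Finset.sum_nonneg fun x hx => ?_)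
  have hne := (Finset.ne_of_mem_erase hx).symm
  rw [flipMatrix, if_neg hne]
  exact mul_nonneg (m.flip_nonneg v x hne) (f.2 x).le

end ActiveParticleModel

/-- The large deviation principle with speed `t`, as `t → ∞`, for the family `Y t` of random
elements of `E`, with the good rate function `I`. -/
structure SatisfiesLDP {Ω E : Type*} [MeasurableSpace Ω] [TopologicalSpace E] (P : Measure Ω)
    (Y : ℝ≥0 → Ω → E) (I : E → EReal) : Prop where
  nonneg : ∀ x, 0 ≤ I x
  lowerSemicontinuous : LowerSemicontinuous I
  compact_sublevel : ∀ c : ℝ, IsCompact {x | I x ≤ (c : EReal)}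
  upper_bound : ∀ B : Set E, IsClosed B →
    limsup (fun t : ℝ≥0 => (((t : ℝ)⁻¹ : ℝ) : EReal) * ENNReal.log (P {ω | Y t ω ∈ B})) atTop
      ≤ -(⨅ x ∈ B, I x)
  lower_bound : ∀ G : Set E, IsOpen G →
    -(⨅ x ∈ G, I x) ≤
      liminf (fun t : ℝ≥0 => (((t : ℝ)⁻¹ : ℝ) : EReal) * ENNReal.log (P {ω | Y t ω ∈ G})) atTop

/-- The Legendre transform `x ↦ sup_α (⟨α, x⟩ - F α)`, with values in the extended reals. -/
def legendreTransform {d : ℕ} (F : EuclideanSpace ℝ (Fin d) → ℝ)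
    (x : EuclideanSpace ℝ (Fin d)) : EReal :=
  ⨆ α : EuclideanSpace ℝ (Fin d), ((inner ℝ α x - F α : ℝ) : EReal)

end

/-!
The matrix `M(α)` has nonnegative irreducible off-diagonal part, hence a real eigenvalue `F(α)` with
positive right and left eigenvectors `r` and `l`. The function `exp ⟨α, x⟩ r(v)` is then an
eigenfunction of `L` with eigenvalue `F(α)`, so that `E exp ⟨α, X_t⟩` equals `exp (t F(α))` up to
constants. Since `L` plus a large constant preserves order, the Markov property, assumed for bounded
functions only, extends to this unbounded one by truncation: from above by Fatou, and from below
because the eigenfunction for `2α` grows like its square.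

Testing the Donsker-Varadhan functional with `f = r` bounds it by `F(α)`, and
`log x ≤ x - 1` yields equality at `μ ∝ l r`; for symmetric rates, completing squares gives the
quadratic formula, with equality at `μ ∝ r²`.

For two parameters, `(F' - F) ⟨l', r⟩ = ⟨l', (M' - M) r⟩`, so the simplicity of the eigenvalue makes
`F` differentiable along lines, and the large deviation principle is the Gärtner-Ellis theorem. Its
lower bound tilts the law exponentially at points which are gradients of `F`; minimisers of
`F(α) + ε ‖α‖² / 2 - ⟨α, x⟩` show that such points approximate every `x` of finite rate.
-/

section Perron

open scoped Matrix

variable {ι : Type*} [Fintype ι]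

theorem mulVec_pos_of_pos {κ : Type*} {E : Matrix κ ι ℝ} (hE : ∀ i j, 0 < E i j) {x : ι → ℝ}
    (hx : ∀ j, 0 ≤ x j) (hx0 : x ≠ 0) (i : κ) : 0 < (E *ᵥ x) i := by
  obtain ⟨j, hj⟩ := Function.ne_iff.1 hx0
  exact Finset.sum_pos' (fun j _ => mul_nonneg (hE i j).le (hx j))
    ⟨j, Finset.mem_univ j, mul_pos (hE i j) ((hx j).lt_of_ne (Ne.symm hj))⟩

theorem ne_zero_of_mem_stdSimplex {x : ι → ℝ} (hx : x ∈ stdSimplex ℝ ι) : x ≠ 0 := by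
  rintro rfl
  simpa using hx.2

theorem inv_sum_smul_mem_stdSimplex [Nonempty ι] {y : ι → ℝ} (hy : ∀ i, 0 < y i) :
    (∑ i, y i)⁻¹ • y ∈ stdSimplex ℝ ι := by
  have hs : 0 < ∑ i, y i := Finset.sum_pos (fun i _ => hy i) Finset.univ_nonempty
  refine ⟨fun i => mul_nonneg (inv_nonneg.2 hs.le) (hy i).le, ?_⟩
  simp only [Pi.smul_apply, smul_eq_mul, ← Finset.mul_sum]
  exact inv_mul_cancel₀ hs.ne'

theorem exists_pos_smul_le {κ : Type*} [Finite κ] [Nonempty κ] {w y : κ → ℝ}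
    (hw : ∀ i, 0 < w i) (hy : ∀ i, 0 < y i) : ∃ ε > (0 : ℝ), ε • y ≤ w := by
  obtain ⟨i₀, hi₀⟩ := Finite.exists_min fun i => w i / y i
  exact ⟨w i₀ / y i₀, div_pos (hw i₀) (hy i₀), fun i => (le_div_iff₀ (hy i)).1 (hi₀ i)⟩

theorem le_sum_of_smul_le_mulVec {B : Matrix ι ι ℝ} (hB : ∀ i j, 0 ≤ B i j) {x : ι → ℝ}
    (hx : x ∈ stdSimplex ℝ ι) {ρ : ℝ} (h : ρ • x ≤ B *ᵥ x) : ρ ≤ ∑ i, ∑ j, B i j := by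
  calc ρ = ∑ i, ρ * x i := by rw [← Finset.mul_sum, hx.2, mul_one]
    _ ≤ ∑ i, (B *ᵥ x) i := Finset.sum_le_sum fun i _ => h i
    _ ≤ ∑ i, ∑ j, B i j := Finset.sum_le_sum fun i _ => Finset.sum_le_sum fun j _ =>
        mul_le_of_le_one_right (hB i j) (mem_Icc_of_mem_stdSimplex hx j).2

theorem exists_max_smul_le_mulVec [Nonempty ι] {B : Matrix ι ι ℝ} (hB : ∀ i j, 0 ≤ B i j) :
    ∃ x ∈ stdSimplex ℝ ι, ∃ ρ : ℝ, ρ • x ≤ B *ᵥ x ∧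
      ∀ y ∈ stdSimplex ℝ ι, ∀ σ : ℝ, σ • y ≤ B *ᵥ y → σ ≤ ρ := by
  classical
  set R := ∑ i, ∑ j, B i j
  have hR : 0 ≤ R := Finset.sum_nonneg fun i _ => Finset.sum_nonneg fun j _ => hB i j
  let S : Set ((ι → ℝ) × ℝ) := (stdSimplex ℝ ι ×ˢ Set.Icc 0 R) ∩ {p | p.2 • p.1 ≤ B *ᵥ p.1}
  have hS : IsCompact S :=
    ((isCompact_stdSimplex ℝ ι).prod isCompact_Icc).inter_right
      (isClosed_le (by fun_prop) (Continuous.matrix_mulVec continuous_const continuous_fst))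
  have hS0 : S.Nonempty := by
    obtain ⟨i₀⟩ := ‹Nonempty ι›
    refine ⟨(Pi.single i₀ 1, 0), ⟨single_mem_stdSimplex ℝ i₀, le_rfl, hR⟩, fun i => ?_⟩
    simpa using hB i i₀
  obtain ⟨⟨x, ρ⟩, ⟨⟨hx, hρ, -⟩, hle⟩, hmax⟩ := hS.exists_isMaxOn hS0 continuous_snd.continuousOn
  refine ⟨x, hx, ρ, hle, fun y hy σ hσ => ?_⟩
  rcases le_or_gt σ 0 with h | h
  · exact h.trans hρ
  · exact hmax (show (y, σ) ∈ S from ⟨⟨hy, h.le, le_sum_of_smul_le_mulVec hB hy hσ⟩, hσ⟩)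

variable [DecidableEq ι]

theorem pow_mulVec_of_mulVec_eq_smul {B : Matrix ι ι ℝ} {x : ι → ℝ} {ρ : ℝ}
    (h : B *ᵥ x = ρ • x) (k : ℕ) : (B ^ k) *ᵥ x = ρ ^ k • x := by
  induction k with
  | zero => simp
  | succ k ih =>
    rw [pow_succ, ← Matrix.mulVec_mulVec, h, Matrix.mulVec_smul, ih, smul_smul, mul_comm, pow_succ]

theorem pos_of_mulVec_eq_smul_of_isPrimitive {B : Matrix ι ι ℝ} (hB : B.IsPrimitive) {x : ι → ℝ}
    (hx : ∀ i, 0 ≤ x i) (hx0 : x ≠ 0) {ρ : ℝ} (h : B *ᵥ x = ρ • x) (i : ι) : 0 < x i := by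
  obtain ⟨k, -, hk⟩ := hB.exists_pos_pow
  have hpos := mulVec_pos_of_pos hk hx hx0 i
  rw [pow_mulVec_of_mulVec_eq_smul h, Pi.smul_apply, smul_eq_mul] at hpos
  exact (hx i).lt_of_ne (right_ne_zero_of_mul hpos.ne').symm

theorem exists_eigenvector_of_isPrimitive [Nonempty ι] {B : Matrix ι ι ℝ} (hB : B.IsPrimitive) :
    ∃ x ∈ stdSimplex ℝ ι, ∃ ρ : ℝ, B *ᵥ x = ρ • x := by
  obtain ⟨k, -, hk⟩ := hB.exists_pos_pow
  obtain ⟨x, hx, ρ, hle, hmax⟩ := exists_max_smul_le_mulVec hB.nonneg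
  refine ⟨x, hx, ρ, ?_⟩
  -- Otherwise `y = B ^ k x` satisfies `ρ y < B y` in every coordinate, so `ρ` is not maximal.
  by_contra hne
  let y := (B ^ k) *ᵥ x
  have hy : ∀ i, 0 < y i := mulVec_pos_of_pos hk hx.1 (ne_zero_of_mem_stdSimplex hx)
  have hdefect : ∀ i, 0 < (B *ᵥ y - ρ • y) i := by
    have hcomm : B *ᵥ y - ρ • y = (B ^ k) *ᵥ (B *ᵥ x - ρ • x) := by
      rw [Matrix.mulVec_sub, Matrix.mulVec_smul, Matrix.mulVec_mulVec, Matrix.mulVec_mulVec,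
        (Commute.pow_self B k).eq]
    rw [hcomm]
    exact mulVec_pos_of_pos hk (sub_nonneg.2 hle) (sub_ne_zero.2 hne)
  obtain ⟨ε, hε, hεy⟩ := exists_pos_smul_le hdefect hy
  have hs : 0 ≤ (∑ i, y i)⁻¹ := inv_nonneg.2 (Finset.sum_nonneg fun i _ => (hy i).le)
  have hle' : (ρ + ε) • ((∑ i, y i)⁻¹ • y) ≤ B *ᵥ ((∑ i, y i)⁻¹ • y) := by
    rw [Matrix.mulVec_smul, smul_comm, add_smul]
    exact smul_le_smul_of_nonneg_left (le_sub_iff_add_le'.1 hεy) hs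
  linarith [hmax _ (inv_sum_smul_mem_stdSimplex hy) _ hle']

theorem pow_apply_pos_succ {B : Matrix ι ι ℝ} (hB : ∀ i j, 0 ≤ B i j) {k : ℕ} {i a b : ι}
    (hia : 0 < (B ^ k) i a) (hab : 0 < B a b) : 0 < (B ^ (k + 1)) i b := by
  rw [pow_succ, Matrix.mul_apply]
  exact Finset.sum_pos' (fun x _ => mul_nonneg (Matrix.pow_apply_nonneg hB k i x) (hB x b))
    ⟨a, Finset.mem_univ a, mul_pos hia hab⟩

theorem isPrimitive_of_diag_pos {B : Matrix ι ι ℝ} (hB : ∀ i j, 0 ≤ B i j)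
    (hdiag : ∀ i, 0 < B i i) (hconn : ∀ i j, Relation.ReflTransGen (fun a b => 0 < B a b) i j) :
    B.IsPrimitive := by
  have hmono : ∀ i j, Monotone fun k => 0 < (B ^ k) i j := fun i j =>
    monotone_nat_of_le_succ fun _ hk => pow_apply_pos_succ hB hk (hdiag j)
  have hex : ∀ i j, ∃ k, 0 < (B ^ k) i j := fun i j => by
    induction hconn i j with
    | refl => exact ⟨0, by simp⟩
    | tail _ hab ih => exact ih.imp' Nat.succ fun k hk => pow_apply_pos_succ hB hk hab
  choose k hk using hex
  refine ⟨hB, ∑ i, ∑ j, k i j + 1, Nat.succ_pos _, fun i j => hmono i j ?_ (hk i j)⟩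
  calc k i j ≤ ∑ j, k i j := Finset.single_le_sum_of_canonicallyOrdered (Finset.mem_univ j)
    _ ≤ ∑ i, ∑ j, k i j :=
        Finset.single_le_sum_of_canonicallyOrdered (f := fun i => ∑ j, k i j) (Finset.mem_univ i)
    _ ≤ ∑ i, ∑ j, k i j + 1 := Nat.le_succ _

end Perron

/-- A square matrix with nonnegative off-diagonal entries whose graph of positive off-diagonal
entries is strongly connected. -/
structure IsMetzlerIrreducible {ι : Type*} (M : Matrix ι ι ℝ) : Prop where
  offDiag_nonneg : ∀ i j, i ≠ j → 0 ≤ M i j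
  irreducible : ∀ i j, Relation.ReflTransGen (fun a b => a ≠ b ∧ 0 < M a b) i j

namespace IsMetzlerIrreducible

open scoped Matrix

variable {ι : Type*} {M : Matrix ι ι ℝ}

theorem transpose (hM : IsMetzlerIrreducible M) : IsMetzlerIrreducible Mᵀ where
  offDiag_nonneg i j h := hM.offDiag_nonneg j i h.symm
  irreducible i j :=
    Relation.ReflTransGen.mono (fun _ _ hab => ⟨hab.1.symm, hab.2⟩) _ _
      (Relation.reflTransGen_swap.2 (hM.irreducible j i))

theorem smul (hM : IsMetzlerIrreducible M) {c : ℝ} (hc : 0 < c) : IsMetzlerIrreducible (c • M) where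
  offDiag_nonneg i j h := mul_nonneg hc.le (hM.offDiag_nonneg i j h)
  irreducible i j :=
    Relation.ReflTransGen.mono (fun _ _ hab => ⟨hab.1, mul_pos hc hab.2⟩) _ _ (hM.irreducible i j)

theorem add_diagonal [DecidableEq ι] (hM : IsMetzlerIrreducible M) (f : ι → ℝ) :
    IsMetzlerIrreducible (M + Matrix.diagonal f) where
  offDiag_nonneg i j h := by
    simpa [Matrix.diagonal_apply_ne f h] using hM.offDiag_nonneg i j h
  irreducible i j := by
    refine Relation.ReflTransGen.mono (fun a b hab => ?_) _ _ (hM.irreducible i j)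
    simpa [Matrix.diagonal_apply_ne f hab.1, hab.1] using hab.2

variable [Fintype ι]

theorem exists_isPrimitive_add_smul_one [DecidableEq ι] (hM : IsMetzlerIrreducible M) :
    ∃ c : ℝ, (M + c • (1 : Matrix ι ι ℝ)).IsPrimitive := by
  refine ⟨1 + ∑ i, |M i i|, ?_⟩
  set B := M + (1 + ∑ i, |M i i|) • (1 : Matrix ι ι ℝ) with hB
  have hdiag : ∀ i, 0 < B i i := fun i => by
    have h1 : |M i i| ≤ ∑ i, |M i i| :=
      Finset.single_le_sum (f := fun i => |M i i|) (fun _ _ => abs_nonneg _) (Finset.mem_univ i)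
    have h2 := neg_abs_le (M i i)
    simp only [hB, Matrix.add_apply, Matrix.smul_apply, Matrix.one_apply_eq, smul_eq_mul, mul_one]
    linarith
  have hoff : ∀ i j, i ≠ j → B i j = M i j := fun i j h => by simp [hB, Matrix.one_apply_ne h]
  refine isPrimitive_of_diag_pos (fun i j => ?_) hdiag fun i j =>
    Relation.ReflTransGen.mono (fun a b hab => (hoff a b hab.1).symm ▸ hab.2) _ _
      (hM.irreducible i j)
  rcases eq_or_ne i j with rfl | h
  · exact (hdiag i).le
  · exact hoff i j h ▸ hM.offDiag_nonneg i j h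

theorem pos_of_eigenvector (hM : IsMetzlerIrreducible M) {x : ι → ℝ} {Λ : ℝ}
    (h : M *ᵥ x = Λ • x) (hx : ∀ i, 0 ≤ x i) (hx0 : x ≠ 0) (i : ι) : 0 < x i := by
  classical
  obtain ⟨c, hc⟩ := hM.exists_isPrimitive_add_smul_one
  refine pos_of_mulVec_eq_smul_of_isPrimitive hc hx hx0 (ρ := Λ + c) ?_ i
  rw [Matrix.add_mulVec, h, Matrix.smul_mulVec, Matrix.one_mulVec, add_smul]

theorem eq_smul_of_eigenvector [Nonempty ι] (hM : IsMetzlerIrreducible M) {r x : ι → ℝ} {Λ : ℝ}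
    (hr : ∀ i, 0 < r i) (hMr : M *ᵥ r = Λ • r) (hMx : M *ᵥ x = Λ • x) : ∃ k : ℝ, x = k • r := by
  -- Subtract the largest multiple of `r` below `x`: the difference has a zero coordinate.
  obtain ⟨i₀, hi₀⟩ := Finite.exists_min fun i => x i / r i
  refine ⟨x i₀ / r i₀, ?_⟩
  by_contra hne
  have hMy : M *ᵥ (x - (x i₀ / r i₀) • r) = Λ • (x - (x i₀ / r i₀) • r) := by
    rw [Matrix.mulVec_sub, Matrix.mulVec_smul, hMr, hMx, smul_sub, smul_comm]
  have hpos := hM.pos_of_eigenvector hMy (fun i => ?_) (sub_ne_zero.2 hne) i₀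
  · simp [div_mul_cancel₀ _ (hr i₀).ne'] at hpos
  · simpa using (le_div_iff₀ (hr i)).1 (hi₀ i)

theorem exists_pos_eigenvector [Nonempty ι] (hM : IsMetzlerIrreducible M) :
    ∃ (Λ : ℝ) (r : ι → ℝ), (∀ i, 0 < r i) ∧ M *ᵥ r = Λ • r := by
  classical
  obtain ⟨c, hc⟩ := hM.exists_isPrimitive_add_smul_one
  obtain ⟨x, hx, ρ, hρ⟩ := exists_eigenvector_of_isPrimitive hc
  have hMx : M *ᵥ x = (ρ - c) • x := by
    rw [sub_smul, ← hρ, Matrix.add_mulVec, Matrix.smul_mulVec, Matrix.one_mulVec,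
      add_sub_cancel_right]
  exact ⟨ρ - c, x, hM.pos_of_eigenvector hMx hx.1 (ne_zero_of_mem_stdSimplex hx), hMx⟩

end IsMetzlerIrreducible

/-- A Perron eigenvalue `Λ` of `M`, with a positive right eigenvector `r` and a positive left
eigenvector `l`. Only `l` is normalised, to total mass one. -/
structure IsPerronTriple {ι : Type*} [Fintype ι] (M : Matrix ι ι ℝ) (Λ : ℝ) (r l : ι → ℝ) :
    Prop where
  right_pos : ∀ i, 0 < r i
  left_pos : ∀ i, 0 < l i
  left_sum : ∑ i, l i = 1
  mulVec_right : M.mulVec r = Λ • r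
  mulVec_left : M.transpose.mulVec l = Λ • l

section PerronTriple

open scoped Matrix

variable {ι : Type*} [Fintype ι] {M : Matrix ι ι ℝ} {Λ : ℝ} {r l : ι → ℝ}

theorem dotProduct_mulVec_of_left_eigenvector (h : Mᵀ *ᵥ l = Λ • l) (x : ι → ℝ) :
    l ⬝ᵥ M *ᵥ x = Λ * l ⬝ᵥ x := by
  rw [Matrix.dotProduct_mulVec, ← Matrix.mulVec_transpose, h, smul_dotProduct, smul_eq_mul]

theorem dotProduct_pos_of_pos [Nonempty ι] {x y : ι → ℝ} (hx : ∀ i, 0 < x i) (hy : ∀ i, 0 < y i) :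
    0 < x ⬝ᵥ y :=
  Finset.sum_pos (fun i _ => mul_pos (hx i) (hy i)) Finset.univ_nonempty

theorem IsMetzlerIrreducible.exists_isPerronTriple [Nonempty ι] (hM : IsMetzlerIrreducible M) :
    ∃ (Λ : ℝ) (r l : ι → ℝ), IsPerronTriple M Λ r l := by
  obtain ⟨Λ, r, hr, hMr⟩ := hM.exists_pos_eigenvector
  obtain ⟨Λ', l, hl, hMl⟩ := hM.transpose.exists_pos_eigenvector
  obtain rfl : Λ = Λ' := by
    have h := dotProduct_mulVec_of_left_eigenvector hMl r
    rw [hMr, dotProduct_smul, smul_eq_mul] at h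
    exact mul_right_cancel₀ (dotProduct_pos_of_pos hl hr).ne' h
  have hs : 0 < ∑ i, l i := Finset.sum_pos (fun i _ => hl i) Finset.univ_nonempty
  exact ⟨Λ, r, (∑ i, l i)⁻¹ • l, hr, fun i => mul_pos (inv_pos.2 hs) (hl i),
    (inv_sum_smul_mem_stdSimplex hl).2, hMr, by rw [Matrix.mulVec_smul, hMl, smul_comm]⟩

theorem re_mul_norm_le_mulVec_norm (hM : ∀ i j, i ≠ j → 0 ≤ M i j) {u : ι → ℂ} {z : ℂ}
    (hu : M.map (fun r : ℝ => (r : ℂ)) *ᵥ u = z • u) (i : ι) :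
    z.re * ‖u i‖ ≤ (M *ᵥ fun j => ‖u j‖) i := by
  classical
  have hrow : (z - M i i) * u i = ∑ j ∈ Finset.univ.erase i, (M i j : ℂ) * u j := by
    have h := congrFun hu i
    simp only [Matrix.mulVec, dotProduct, Matrix.map_apply, Pi.smul_apply, smul_eq_mul] at h
    rw [sub_mul, ← h, ← Finset.add_sum_erase _ _ (Finset.mem_univ i), add_sub_cancel_left]
  have hoff : (z.re - M i i) * ‖u i‖ ≤ ∑ j ∈ Finset.univ.erase i, M i j * ‖u j‖ := by
    calc (z.re - M i i) * ‖u i‖ ≤ ‖z - M i i‖ * ‖u i‖ :=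
          mul_le_mul_of_nonneg_right (by simpa using Complex.re_le_norm (z - M i i))
            (norm_nonneg _)
      _ = ‖∑ j ∈ Finset.univ.erase i, (M i j : ℂ) * u j‖ := by rw [← norm_mul, hrow]
      _ ≤ ∑ j ∈ Finset.univ.erase i, ‖(M i j : ℂ) * u j‖ := norm_sum_le _ _
      _ = ∑ j ∈ Finset.univ.erase i, M i j * ‖u j‖ := Finset.sum_congr rfl fun j hj => by
          rw [norm_mul, Complex.norm_of_nonneg (hM i j (Finset.ne_of_mem_erase hj).symm)]
  simp only [Matrix.mulVec, dotProduct]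
  rw [← Finset.add_sum_erase _ _ (Finset.mem_univ i)]
  linarith

/-- The infimum over positive `f` of the `μ`-average of `M f / f`. -/
noncomputable def donskerVaradhanInf (M : Matrix ι ι ℝ) (μ : ι → ℝ) : ℝ :=
  ⨅ f : {f : ι → ℝ // ∀ i, 0 < f i}, ∑ i, (M *ᵥ f.1) i / f.1 i * μ i

theorem bddBelow_donskerVaradhanInf (hM : ∀ i j, i ≠ j → 0 ≤ M i j) {μ : ι → ℝ}
    (hμ : ∀ i, 0 ≤ μ i) :
    BddBelow (Set.range fun f : {f : ι → ℝ // ∀ i, 0 < f i} =>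
      ∑ i, (M *ᵥ f.1) i / f.1 i * μ i) := by
  classical
  refine ⟨∑ i, M i i * μ i, ?_⟩
  rintro _ ⟨f, rfl⟩
  refine Finset.sum_le_sum fun i _ => mul_le_mul_of_nonneg_right ?_ (hμ i)
  rw [le_div_iff₀ (f.2 i)]
  simp only [Matrix.mulVec, dotProduct]
  rw [← Finset.add_sum_erase _ _ (Finset.mem_univ i)]
  exact le_add_of_nonneg_right <| Finset.sum_nonneg fun j hj =>
    mul_nonneg (hM i j (Finset.ne_of_mem_erase hj).symm) (f.2 j).le

namespace IsPerronTriple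

theorem left_mem_stdSimplex (h : IsPerronTriple M Λ r l) : l ∈ stdSimplex ℝ ι :=
  ⟨fun i => (h.left_pos i).le, h.left_sum⟩

theorem nonempty (h : IsPerronTriple M Λ r l) : Nonempty ι := by
  by_contra hι
  rw [not_nonempty_iff] at hι
  simpa using h.left_sum

theorem hasEigenvalue [DecidableEq ι] (h : IsPerronTriple M Λ r l) :
    Module.End.HasEigenvalue (Matrix.toLin' M) Λ := by
  obtain ⟨i⟩ := h.nonempty
  refine Module.End.hasEigenvalue_of_hasEigenvector (x := r)
    ⟨Module.End.mem_eigenspace_iff.2 (by rw [Matrix.toLin'_apply, h.mulVec_right]), ?_⟩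
  exact fun h0 => (h.right_pos i).ne' (congrFun h0 i)

theorem re_le_of_hasEigenvalue [DecidableEq ι] (h : IsPerronTriple M Λ r l)
    (hM : ∀ i j, i ≠ j → 0 ≤ M i j) {z : ℂ}
    (hz : Module.End.HasEigenvalue (Matrix.toLin' (M.map (fun r : ℝ => (r : ℂ)))) z) :
    z.re ≤ Λ := by
  obtain ⟨u, hu, hu0⟩ := hz.exists_hasEigenvector
  rw [Module.End.mem_eigenspace_iff, Matrix.toLin'_apply] at hu
  have hle : z.re * l ⬝ᵥ (fun i => ‖u i‖) ≤ Λ * l ⬝ᵥ (fun i => ‖u i‖) := by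
    rw [← dotProduct_mulVec_of_left_eigenvector h.mulVec_left, ← smul_eq_mul, ← dotProduct_smul]
    exact Finset.sum_le_sum fun i _ =>
      mul_le_mul_of_nonneg_left (re_mul_norm_le_mulVec_norm hM hu i) (h.left_pos i).le
  obtain ⟨i, hi⟩ := Function.ne_iff.1 hu0
  exact le_of_mul_le_mul_right hle <|
    Finset.sum_pos' (fun j _ => mul_nonneg (h.left_pos j).le (norm_nonneg _))
      ⟨i, Finset.mem_univ i, mul_pos (h.left_pos i) (norm_pos_iff.2 hi)⟩

theorem mulVec_right_apply (h : IsPerronTriple M Λ r l) (i : ι) :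
    ∑ j, M i j * r j = Λ * r i := congrFun h.mulVec_right i

theorem mulVec_left_apply (h : IsPerronTriple M Λ r l) (j : ι) :
    ∑ i, l i * M i j = Λ * l j := by
  simpa [Matrix.mulVec, dotProduct, mul_comm] using congrFun h.mulVec_left j

theorem sum_sum_mul_row (h : IsPerronTriple M Λ r l) (a : ι → ℝ) :
    ∑ i, ∑ j, l i * M i j * r j * a i = Λ * ∑ i, l i * r i * a i := by
  rw [Finset.mul_sum]
  refine Finset.sum_congr rfl fun i _ => ?_
  calc ∑ j, l i * M i j * r j * a i = l i * a i * ∑ j, M i j * r j := by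
        rw [Finset.mul_sum]
        exact Finset.sum_congr rfl fun j _ => by ring
    _ = Λ * (l i * r i * a i) := by rw [h.mulVec_right_apply]; ring

theorem sum_sum_mul_col (h : IsPerronTriple M Λ r l) (a : ι → ℝ) :
    ∑ i, ∑ j, l i * M i j * r j * a j = Λ * ∑ i, l i * r i * a i := by
  rw [Finset.sum_comm, Finset.mul_sum]
  refine Finset.sum_congr rfl fun j _ => ?_
  calc ∑ i, l i * M i j * r j * a j = r j * a j * ∑ i, l i * M i j := by
        rw [Finset.mul_sum]
        exact Finset.sum_congr rfl fun i _ => by ring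
    _ = Λ * (l j * r j * a j) := by rw [h.mulVec_left_apply]; ring

theorem le_mul_div_of_pos (h : IsPerronTriple M Λ r l) (hM : ∀ i j, i ≠ j → 0 ≤ M i j)
    {f : ι → ℝ} (hf : ∀ i, 0 < f i) (i j : ι) :
    l i * M i j * r j * (1 + Real.log (f j / r j) - Real.log (f i / r i)) ≤
      M i j * f j / f i * (l i * r i) := by
  have hratio : ∀ k, 0 < f k / r k := fun k => div_pos (hf k) (h.right_pos k)
  have hfi := (hf i).ne'
  have hri := (h.right_pos i).ne'
  have hrj := (h.right_pos j).ne'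
  rcases eq_or_ne i j with rfl | hij
  · refine le_of_eq ?_
    field_simp
    ring
  · have hlog : Real.log (f j / r j) - Real.log (f i / r i) ≤ (f j / r j) / (f i / r i) - 1 := by
      rw [← Real.log_div (hratio j).ne' (hratio i).ne']
      exact Real.log_le_sub_one_of_pos (div_pos (hratio j) (hratio i))
    have heq : M i j * f j / f i * (l i * r i) =
        l i * M i j * r j * ((f j / r j) / (f i / r i)) := by
      field_simp
    rw [heq]
    exact mul_le_mul_of_nonneg_left (by linarith)
      (mul_nonneg (mul_nonneg (h.left_pos i).le (hM i j hij)) (h.right_pos j).le)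

theorem le_sum_mulVec_div (h : IsPerronTriple M Λ r l) (hM : ∀ i j, i ≠ j → 0 ≤ M i j)
    {f : ι → ℝ} (hf : ∀ i, 0 < f i) :
    Λ * l ⬝ᵥ r ≤ ∑ i, (M *ᵥ f) i / f i * (l i * r i) := by
  set g : ι → ℝ := fun i => Real.log (f i / r i)
  calc Λ * l ⬝ᵥ r = ∑ i, ∑ j, l i * M i j * r j * (1 + g j - g i) := by
        have h1 := h.sum_sum_mul_row fun _ => 1
        simp only [mul_one] at h1
        simp only [mul_sub, mul_add, mul_one, Finset.sum_sub_distrib, Finset.sum_add_distrib,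
          h1, h.sum_sum_mul_row g, h.sum_sum_mul_col g, add_sub_cancel_right, dotProduct]
    _ ≤ ∑ i, ∑ j, M i j * f j / f i * (l i * r i) :=
        Finset.sum_le_sum fun i _ => Finset.sum_le_sum fun j _ => h.le_mul_div_of_pos hM hf i j
    _ = ∑ i, (M *ᵥ f) i / f i * (l i * r i) :=
        Finset.sum_congr rfl fun i _ => by
          rw [← Finset.sum_mul, ← Finset.sum_div, Matrix.mulVec, dotProduct]

/-- The maximiser is the normalised product of the left and right eigenvectors. -/
theorem isGreatest_donskerVaradhanInf (h : IsPerronTriple M Λ r l)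
    (hM : ∀ i j, i ≠ j → 0 ≤ M i j) :
    IsGreatest (donskerVaradhanInf M '' stdSimplex ℝ ι) Λ := by
  have hι := h.nonempty
  have hle : ∀ μ ∈ stdSimplex ℝ ι, donskerVaradhanInf M μ ≤ Λ := fun μ hμ => by
    refine (ciInf_le (bddBelow_donskerVaradhanInf hM hμ.1) ⟨r, h.right_pos⟩).trans_eq ?_
    simp only [h.mulVec_right, Pi.smul_apply, smul_eq_mul,
      mul_div_cancel_right₀ _ (h.right_pos _).ne', ← Finset.mul_sum, hμ.2, mul_one]
  have hlr : ∀ i, 0 < (l * r) i := fun i => mul_pos (h.left_pos i) (h.right_pos i)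
  have hμ := inv_sum_smul_mem_stdSimplex hlr
  refine ⟨⟨(∑ i, (l * r) i)⁻¹ • (l * r), hμ, (hle _ hμ).antisymm ?_⟩, Set.forall_mem_image.2 hle⟩
  have : Nonempty {f : ι → ℝ // ∀ i, 0 < f i} := ⟨⟨r, h.right_pos⟩⟩
  refine le_ciInf fun f => ?_
  have hs : 0 < ∑ i, l i * r i := Finset.sum_pos (fun i _ => hlr i) Finset.univ_nonempty
  simp only [Pi.smul_apply, smul_eq_mul, Pi.mul_apply, mul_left_comm _ (∑ i, l i * r i)⁻¹,
    ← Finset.mul_sum]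
  rw [le_inv_mul_iff₀ hs, mul_comm]
  exact h.le_sum_mulVec_div hM f.2

theorem mul_mul_le_of_symm (h : IsPerronTriple M Λ r l) (hM : ∀ i j, i ≠ j → 0 ≤ M i j)
    (hsymm : ∀ i j, M i j = M j i) (x : ι → ℝ) (i j : ι) :
    x i * x j * M i j ≤ (x i ^ 2 / r i * (M i j * r j) + x j ^ 2 / r j * (M j i * r i)) / 2 := by
  have hri := h.right_pos i
  have hrj := h.right_pos j
  have hsq : (x i ^ 2 / r i * (M i j * r j) + x j ^ 2 / r j * (M j i * r i)) / 2 -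
      x i * x j * M i j = M i j * (r i * r j) * (x i / r i - x j / r j) ^ 2 / 2 := by
    rw [hsymm j i]
    field_simp
    ring
  rw [← sub_nonneg, hsq]
  rcases eq_or_ne i j with rfl | hij
  · simp
  · have := hM i j hij
    positivity

theorem sum_sum_mul_le_of_symm (h : IsPerronTriple M Λ r l) (hM : ∀ i j, i ≠ j → 0 ≤ M i j)
    (hsymm : ∀ i j, M i j = M j i) (x : ι → ℝ) :
    ∑ i, ∑ j, x i * x j * M i j ≤ Λ * ∑ i, x i ^ 2 := by
  have hS : ∑ i, ∑ j, x i ^ 2 / r i * (M i j * r j) = Λ * ∑ i, x i ^ 2 := by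
    rw [Finset.mul_sum]
    refine Finset.sum_congr rfl fun i _ => ?_
    rw [← Finset.mul_sum, h.mulVec_right_apply]
    have := (h.right_pos i).ne'
    field_simp
  calc ∑ i, ∑ j, x i * x j * M i j
      ≤ ∑ i, ∑ j, (x i ^ 2 / r i * (M i j * r j) + x j ^ 2 / r j * (M j i * r i)) / 2 :=
        Finset.sum_le_sum fun i _ => Finset.sum_le_sum fun j _ =>
          h.mul_mul_le_of_symm hM hsymm x i j
    _ = Λ * ∑ i, x i ^ 2 := by
        simp only [← Finset.sum_div, Finset.sum_add_distrib]
        rw [Finset.sum_comm (f := fun i j => x j ^ 2 / r j * (M j i * r i)), hS, add_self_div_two]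

/-- The maximiser is the normalised square of the right eigenvector. -/
theorem isGreatest_sum_sqrt_mul_sqrt (h : IsPerronTriple M Λ r l)
    (hM : ∀ i j, i ≠ j → 0 ≤ M i j) (hsymm : ∀ i j, M i j = M j i) :
    IsGreatest ((fun μ : ι → ℝ => ∑ i, ∑ j, √(μ i) * √(μ j) * M i j) '' stdSimplex ℝ ι) Λ := by
  have hι := h.nonempty
  refine ⟨⟨_, inv_sum_smul_mem_stdSimplex fun i => pow_pos (h.right_pos i) 2, ?_⟩, ?_⟩
  · have hs : 0 < ∑ i, r i ^ 2 :=
      Finset.sum_pos (fun i _ => pow_pos (h.right_pos i) 2) Finset.univ_nonempty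
    have hterm : ∀ i j, √((∑ i, r i ^ 2)⁻¹ * r i ^ 2) * √((∑ i, r i ^ 2)⁻¹ * r j ^ 2) * M i j =
        (∑ i, r i ^ 2)⁻¹ * (r i * (M i j * r j)) := fun i j => by
      rw [Real.sqrt_mul (inv_nonneg.2 hs.le), Real.sqrt_mul (inv_nonneg.2 hs.le),
        Real.sqrt_sq (h.right_pos i).le, Real.sqrt_sq (h.right_pos j).le, mul_mul_mul_comm,
        Real.mul_self_sqrt (inv_nonneg.2 hs.le)]
      ring
    simp only [Pi.smul_apply, smul_eq_mul, hterm, ← Finset.mul_sum, h.mulVec_right_apply,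
      mul_left_comm _ Λ, ← pow_two, inv_mul_cancel₀ hs.ne', mul_one]
  · rintro _ ⟨μ, hμ, rfl⟩
    refine (h.sum_sum_mul_le_of_symm hM hsymm fun i => √(μ i)).trans_eq ?_
    simp only [Real.sq_sqrt (hμ.1 _), hμ.2, mul_one]

theorem sub_mul_dotProduct {M' : Matrix ι ι ℝ} {Λ' : ℝ} {r' l' : ι → ℝ}
    (h : IsPerronTriple M Λ r l) (h' : IsPerronTriple M' Λ' r' l') :
    (Λ' - Λ) * l' ⬝ᵥ r = l' ⬝ᵥ (M' - M) *ᵥ r := by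
  rw [Matrix.sub_mulVec, dotProduct_sub, dotProduct_mulVec_of_left_eigenvector h'.mulVec_left,
    h.mulVec_right, dotProduct_smul, smul_eq_mul, sub_mul]

theorem abs_dotProduct_left_le (h : IsPerronTriple M Λ r l) (x : ι → ℝ) : |l ⬝ᵥ x| ≤ ‖x‖ := by
  calc |l ⬝ᵥ x| ≤ ∑ i, |l i * x i| := Finset.abs_sum_le_sum_abs _ _
    _ ≤ ∑ i, l i * ‖x‖ := Finset.sum_le_sum fun i _ => by
        rw [abs_mul, abs_of_pos (h.left_pos i)]
        exact mul_le_mul_of_nonneg_left (norm_le_pi_norm x i) (h.left_pos i).le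
    _ = ‖x‖ := by rw [← Finset.sum_mul, h.left_sum, one_mul]

theorem le_dotProduct_left (h : IsPerronTriple M Λ r l) {x : ι → ℝ} {c : ℝ} (hx : ∀ i, c ≤ x i) :
    c ≤ l ⬝ᵥ x := by
  calc c = ∑ i, l i * c := by rw [← Finset.sum_mul, h.left_sum, one_mul]
    _ ≤ l ⬝ᵥ x := Finset.sum_le_sum fun i _ => mul_le_mul_of_nonneg_left (hx i) (h.left_pos i).le

section Perturbation

variable {β : Type*} {𝓕 : Filter β} {M' : β → Matrix ι ι ℝ} {Λ' : β → ℝ} {r' l' : β → ι → ℝ}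

theorem tendsto_eigenvalue (h : IsPerronTriple M Λ r l)
    (h' : ∀ s, IsPerronTriple (M' s) (Λ' s) (r' s) (l' s)) (hM' : Tendsto M' 𝓕 (𝓝 M)) :
    Tendsto Λ' 𝓕 (𝓝 Λ) := by
  have := h.nonempty
  obtain ⟨i₀, hi₀⟩ := Finite.exists_min r
  have hbound : ∀ s, ‖Λ' s - Λ‖ ≤ ‖(M' s - M) *ᵥ r‖ / r i₀ := fun s => by
    rw [le_div_iff₀ (h.right_pos i₀), Real.norm_eq_abs]
    calc |Λ' s - Λ| * r i₀ ≤ |Λ' s - Λ| * l' s ⬝ᵥ r :=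
          mul_le_mul_of_nonneg_left ((h' s).le_dotProduct_left hi₀) (abs_nonneg _)
      _ = |l' s ⬝ᵥ (M' s - M) *ᵥ r| := by
          rw [← h.sub_mul_dotProduct (h' s), abs_mul,
            abs_of_pos (dotProduct_pos_of_pos (h' s).left_pos h.right_pos)]
      _ ≤ ‖(M' s - M) *ᵥ r‖ := (h' s).abs_dotProduct_left_le _
  refine tendsto_iff_norm_sub_tendsto_zero.2 (squeeze_zero (fun _ => norm_nonneg _) hbound ?_)
  have hcont : Continuous fun N : Matrix ι ι ℝ => ‖(N - M) *ᵥ r‖ / r i₀ :=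
    ((continuous_id.sub continuous_const).matrix_mulVec continuous_const).norm.div_const _
  have h0 := (hcont.tendsto M).comp hM'
  rwa [sub_self, Matrix.zero_mulVec, norm_zero, zero_div] at h0

theorem tendsto_left (h : IsPerronTriple M Λ r l) (hM : IsMetzlerIrreducible M)
    (h' : ∀ s, IsPerronTriple (M' s) (Λ' s) (r' s) (l' s)) (hM' : Tendsto M' 𝓕 (𝓝 M)) :
    Tendsto l' 𝓕 (𝓝 l) := by
  have := h.nonempty
  refine (isCompact_stdSimplex ℝ ι).tendsto_nhds_of_unique_mapClusterPt
    (Eventually.of_forall fun s => (h' s).left_mem_stdSimplex) fun y hy hcluster => ?_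
  obtain ⟨U, hU, hlU⟩ := mapClusterPt_iff_ultrafilter.1 hcluster
  have hMy : Mᵀ *ᵥ y = Λ • y := by
    have hΛU := (h.tendsto_eigenvalue h' hM').mono_left hU
    have hmulVec : Continuous fun p : Matrix ι ι ℝ × (ι → ℝ) => p.1ᵀ *ᵥ p.2 :=
      continuous_fst.matrix_transpose.matrix_mulVec continuous_snd
    refine tendsto_nhds_unique ((hmulVec.tendsto (M, y)).comp
      ((hM'.mono_left hU).prodMk_nhds hlU)) ((hΛU.smul hlU).congr fun s => ?_)
    exact ((h' s).mulVec_left).symm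
  obtain ⟨k, rfl⟩ := hM.transpose.eq_smul_of_eigenvector h.left_pos h.mulVec_left hMy
  obtain rfl : k = 1 := by simpa [← Finset.mul_sum, h.left_sum] using hy.2
  exact one_smul ℝ l

end Perturbation

theorem differentiableAt_eigenvalue {M : ℝ → Matrix ι ι ℝ} {Λ : ℝ → ℝ} {r l : ℝ → ι → ℝ}
    (h : ∀ s, IsPerronTriple (M s) (Λ s) (r s) (l s)) {s₀ : ℝ}
    (hM : IsMetzlerIrreducible (M s₀))
    (hdiff : ∀ i j, DifferentiableAt ℝ (fun s => M s i j) s₀) : DifferentiableAt ℝ Λ s₀ := by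
  have := (h s₀).nonempty
  have hpos : ∀ s, 0 < l s ⬝ᵥ r s₀ := fun s => dotProduct_pos_of_pos (h s).left_pos (h s₀).right_pos
  have hslope : slope Λ s₀ =
      fun s => (l s ⬝ᵥ ((s - s₀)⁻¹ • (M s - M s₀)) *ᵥ r s₀) / l s ⬝ᵥ r s₀ := by
    ext s
    rw [eq_div_iff (hpos s).ne', slope_def_field, Matrix.smul_mulVec, dotProduct_smul,
      ← (h s₀).sub_mul_dotProduct (h s), smul_eq_mul, div_eq_inv_mul, mul_assoc]
  have hM' : Tendsto (fun s => (s - s₀)⁻¹ • (M s - M s₀)) (𝓝[≠] s₀)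
      (𝓝 (Matrix.of fun i j => deriv (fun s => M s i j) s₀)) :=
    tendsto_pi_nhds.2 fun i => tendsto_pi_nhds.2 fun j =>
      hasDerivAt_iff_tendsto_slope.1 (hdiff i j).hasDerivAt
  have hcont : Tendsto M (𝓝 s₀) (𝓝 (M s₀)) :=
    tendsto_pi_nhds.2 fun i => tendsto_pi_nhds.2 fun j => (hdiff i j).continuousAt
  have hl : Tendsto l (𝓝[≠] s₀) (𝓝 (l s₀)) :=
    ((h s₀).tendsto_left hM h hcont).mono_left nhdsWithin_le_nhds
  have hpair : Continuous fun p : (ι → ℝ) × Matrix ι ι ℝ => p.1 ⬝ᵥ p.2 *ᵥ r s₀ :=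
    continuous_fst.dotProduct (continuous_snd.matrix_mulVec continuous_const)
  have hden : Continuous fun x : ι → ℝ => x ⬝ᵥ r s₀ := continuous_id.dotProduct continuous_const
  have hderiv : HasDerivAt Λ ((l s₀ ⬝ᵥ
      (Matrix.of fun i j => deriv (fun s => M s i j) s₀) *ᵥ r s₀) / l s₀ ⬝ᵥ r s₀) s₀ := by
    rw [hasDerivAt_iff_tendsto_slope, hslope]
    exact ((hpair.tendsto (_, _)).comp (hl.prodMk_nhds hM')).div ((hden.tendsto _).comp hl)
      (hpos s₀).ne'
  exact hderiv.differentiableAt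

end IsPerronTriple

end PerronTriple

theorem latticeVec_add {d : ℕ} (x y : IntLattice d) :
    latticeVec (x + y) = latticeVec x + latticeVec y := by
  ext i
  simp [latticeVec]

theorem latticeVec_zero {d : ℕ} : latticeVec (0 : IntLattice d) = 0 := by
  ext i
  simp [latticeVec]

theorem hasSum_expSemigroup {B : Type*} [NormedAddCommGroup B] [NormedSpace ℝ B] [CompleteSpace B]
    (L : B →L[ℝ] B) (c : ℝ) (t : ℝ≥0) (f : B) (φ : B →L[ℝ] ℝ) :
    HasSum (fun n : ℕ => Real.exp (-(t * c)) * ((n.factorial : ℝ)⁻¹ * (t : ℝ) ^ n *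
      φ (((L + c • (1 : B →L[ℝ] B)) ^ n) f))) (φ (expSemigroup L t f)) := by
  let _ : NormedAlgebra ℚ (B →L[ℝ] B) := NormedAlgebra.restrictScalars ℚ ℝ _
  set Q := L + c • (1 : B →L[ℝ] B) with hQ
  have hshift : expSemigroup L t = Real.exp (-(t * c)) • NormedSpace.exp ((t : ℝ) • Q) := by
    have hL : (t : ℝ) • L = algebraMap ℝ (B →L[ℝ] B) (-(t * c)) + (t : ℝ) • Q := by
      rw [hQ, smul_add, Algebra.algebraMap_eq_smul_one, smul_smul, neg_smul]
      abel
    rw [expSemigroup, hL, NormedSpace.exp_add_of_commute (Algebra.commutes _ _),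
      ← NormedSpace.algebraMap_exp_comm, ← Real.exp_eq_exp_ℝ,
      Algebra.algebraMap_eq_smul_one, smul_one_mul]
  have hseries := ((NormedSpace.exp_series_hasSum_exp' (𝕂 := ℝ) ((t : ℝ) • Q)).mapL
    (φ.comp (ContinuousLinearMap.apply ℝ B f))).mul_left (Real.exp (-(t * c)))
  rw [hshift, smul_apply, map_smul, smul_eq_mul]
  refine hseries.congr_fun fun n => ?_
  rw [smul_pow, smul_smul, map_smul, smul_eq_mul]
  rfl

theorem hasSum_exp_shift (t c F : ℝ) :
    HasSum (fun n : ℕ => Real.exp (-(t * c)) * ((n.factorial : ℝ)⁻¹ * t ^ n * (F + c) ^ n))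
      (Real.exp (t * F)) := by
  have h := (NormedSpace.exp_series_hasSum_exp' (𝕂 := ℝ) (t * (F + c))).mul_left
    (Real.exp (-(t * c)))
  rw [← Real.exp_eq_exp_ℝ, ← Real.exp_add, show -(t * c) + t * (F + c) = t * F by ring] at h
  refine h.congr_fun fun n => ?_
  rw [smul_eq_mul, mul_pow, mul_assoc]

theorem integrable_and_integral_le_of_integral_min_le {Ω : Type*} [MeasurableSpace Ω]
    {μ : Measure Ω} [IsFiniteMeasure μ] {f : Ω → ℝ} (hf : Measurable f) (hf0 : ∀ ω, 0 ≤ f ω) {C : ℝ}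
    (hC : ∀ n : ℕ, ∫ ω, min (f ω) n ∂μ ≤ C) : Integrable f μ ∧ ∫ ω, f ω ∂μ ≤ C := by
  have hmin0 : ∀ (n : ℕ) ω, 0 ≤ min (f ω) n := fun n ω => le_min (hf0 ω) n.cast_nonneg
  have hmin : ∀ n : ℕ, Integrable (fun ω => min (f ω) n) μ := fun n =>
    Integrable.of_bound (hf.min measurable_const).aestronglyMeasurable n
      (Eventually.of_forall fun ω => by
        rw [Real.norm_of_nonneg (hmin0 n ω)]
        exact min_le_right _ _)
  have hle : ∫⁻ ω, ENNReal.ofReal (f ω) ∂μ ≤ ENNReal.ofReal C := by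
    have hlim := lintegral_tendsto_of_tendsto_of_monotone (μ := μ)
      (f := fun (n : ℕ) ω => ENNReal.ofReal (min (f ω) n)) (F := fun ω => ENNReal.ofReal (f ω))
      (fun n => (hf.min measurable_const).ennreal_ofReal.aemeasurable)
      (Eventually.of_forall fun ω a b hab =>
        ENNReal.ofReal_le_ofReal (min_le_min_left _ (Nat.cast_le.2 hab)))
      (Eventually.of_forall fun ω => by
        refine tendsto_const_nhds.congr' ?_
        obtain ⟨K, hK⟩ := exists_nat_ge (f ω)
        filter_upwards [eventually_ge_atTop K] with n hn
        rw [min_eq_left (hK.trans (Nat.cast_le.2 hn))])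
    refine le_of_tendsto' hlim fun n => ?_
    rw [← ofReal_integral_eq_lintegral_ofReal (hmin n) (Eventually.of_forall (hmin0 n))]
    exact ENNReal.ofReal_le_ofReal (hC n)
  have hC0 : 0 ≤ C := (integral_nonneg (hmin0 0)).trans (hC 0)
  refine ⟨⟨hf.aestronglyMeasurable, ?_⟩, ?_⟩
  · rw [hasFiniteIntegral_iff_ofReal (Eventually.of_forall hf0)]
    exact hle.trans_lt ENNReal.ofReal_lt_top
  · rw [integral_eq_lintegral_of_nonneg_ae (Eventually.of_forall hf0) hf.aestronglyMeasurable]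
    exact ENNReal.toReal_le_of_le_ofReal hC0 hle

namespace ActiveParticleModel

section Generator

variable {d : ℕ} {m : ActiveParticleModel d} {f g : m.State → ℝ}

/-- The functions to which the expression `generatorFun` applies without junk values: the sum
defining `diffusion` converges. -/
def DiffusionSummable (f : m.State → ℝ) : Prop :=
  ∀ s : m.State, Summable fun z : IntLattice d => m.p z * (f (s.1 + z, s.2) - f s)

theorem DiffusionSummable.add_smul (hf : DiffusionSummable f) (hg : DiffusionSummable g)
    (a b : ℝ) : DiffusionSummable fun s => a * f s + b * g s := fun s =>
  (((hf s).mul_left a).add ((hg s).mul_left b)).congr fun z => by ring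

theorem diffusion_add_smul (hf : DiffusionSummable f) (hg : DiffusionSummable g) (a b : ℝ)
    (s : m.State) : m.diffusion (fun s => a * f s + b * g s) s =
      a * m.diffusion f s + b * m.diffusion g s := by
  unfold diffusion
  rw [← tsum_mul_left, ← tsum_mul_left, ← ((hf s).mul_left a).tsum_add ((hg s).mul_left b)]
  exact tsum_congr fun z => by ring

theorem flipGen_add_smul (f g : m.V → ℝ) (a b : ℝ) (v : m.V) :
    m.flipGen (fun v => a * f v + b * g v) v = a * m.flipGen f v + b * m.flipGen g v := by
  simp only [flipGen, Finset.mul_sum, ← Finset.sum_add_distrib]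
  exact Finset.sum_congr rfl fun z _ => by ring

theorem generatorFun_add_smul (hf : DiffusionSummable f) (hg : DiffusionSummable g) (a b : ℝ)
    (s : m.State) : m.generatorFun (fun s => a * f s + b * g s) s =
      a * m.generatorFun f s + b * m.generatorFun g s := by
  simp only [generatorFun, transport, diffusion_add_smul hf hg, flipGen_add_smul]
  ring

theorem diffusion_add_self_mono (hf : DiffusionSummable f) (hg : DiffusionSummable g)
    (hfg : ∀ s, f s ≤ g s) (s : m.State) : m.diffusion f s + f s ≤ m.diffusion g s + g s := by
  have hsum : ∀ f : m.State → ℝ, DiffusionSummable f →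
      HasSum (fun z => m.p z * f (s.1 + z, s.2)) (m.diffusion f s + f s) := fun f hf => by
    have h := (hf s).hasSum.add (m.p_hasSum.mul_right (f s))
    rw [one_mul] at h
    exact h.congr_fun fun z => by ring
  exact hasSum_le (fun z => mul_le_mul_of_nonneg_left (hfg _) (m.p_nonneg z)) (hsum f hf)
    (hsum g hg)

theorem flipGen_add_sum_abs_mul_mono {f g : m.V → ℝ} (hfg : ∀ v, f v ≤ g v) (v : m.V) :
    m.flipGen f v + (∑ w : m.V, ∑ w' : m.V, |m.flip w w'|) * f v ≤
      m.flipGen g v + (∑ w : m.V, ∑ w' : m.V, |m.flip w w'|) * g v := by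
  have hrow : ∑ v' : m.V, |m.flip v v'| ≤ ∑ w : m.V, ∑ w' : m.V, |m.flip w w'| :=
    Finset.single_le_sum (f := fun w : m.V => ∑ w' : m.V, |m.flip w w'|)
      (fun w _ => Finset.sum_nonneg fun w' _ => abs_nonneg _) (Finset.mem_univ v)
  have hflip : m.flipGen f v + (∑ v' : m.V, |m.flip v v'|) * f v ≤
      m.flipGen g v + (∑ v' : m.V, |m.flip v v'|) * g v := by
    simp only [flipGen, Finset.sum_mul, ← Finset.sum_add_distrib]
    refine Finset.sum_le_sum fun v' _ => ?_
    rcases eq_or_ne v v' with rfl | h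
    · simpa using mul_le_mul_of_nonneg_left (hfg v) (abs_nonneg (m.flip v v))
    · rw [abs_of_nonneg (m.flip_nonneg _ _ h)]
      linarith [mul_le_mul_of_nonneg_left (hfg v') (m.flip_nonneg _ _ h)]
  linarith [mul_le_mul_of_nonneg_right hrow (sub_nonneg.2 (hfg v))]

variable (m) in
/-- An upper bound for the total jump rate out of a state: adding it to the generator gives an
operator which preserves order. -/
def totalRate : ℝ := m.lam + m.kap + m.gam * ∑ v : m.V, ∑ v' : m.V, |m.flip v v'|

theorem generatorFun_add_totalRate_mono (hf : DiffusionSummable f) (hg : DiffusionSummable g)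
    (hfg : ∀ s, f s ≤ g s) (s : m.State) :
    m.generatorFun f s + m.totalRate * f s ≤ m.generatorFun g s + m.totalRate * g s := by
  have htransport : m.transport f s + f s ≤ m.transport g s + g s := by
    simpa only [transport, sub_add_cancel] using hfg _
  have hdiffusion := diffusion_add_self_mono hf hg hfg s
  have hflip := flipGen_add_sum_abs_mul_mono (fun v => hfg (s.1, v)) s.2
  simp only [generatorFun, totalRate]
  linarith [mul_le_mul_of_nonneg_left htransport m.lam_nonneg,
    mul_le_mul_of_nonneg_left hdiffusion m.kap_nonneg,
    mul_le_mul_of_nonneg_left hflip m.gam_pos.le]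

theorem le_pow_generator_add_totalRate {g : ℕ → m.State → ℝ} (hg : ∀ n, DiffusionSummable (g n))
    (hsucc : ∀ n s, m.generatorFun (g n) s + m.totalRate * g n s = g (n + 1) s)
    {f : m.State →ᵇ ℝ} (hf : ∀ s, g 0 s ≤ f s) (n : ℕ) (s : m.State) :
    g n s ≤ ((m.generator + m.totalRate • (1 : (m.State →ᵇ ℝ) →L[ℝ] (m.State →ᵇ ℝ))) ^ n) f s := by
  induction n generalizing s with
  | zero => exact hf s
  | succ n ih =>
    rw [← hsucc, pow_succ']
    exact generatorFun_add_totalRate_mono (hg n) (m.summable_diffusion _) ih s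

/-- A possibly unbounded eigenfunction of the generator, with eigenvalue `F`. -/
structure IsEigenfunction (g : m.State → ℝ) (F : ℝ) : Prop where
  diffusionSummable : DiffusionSummable g
  generatorFun_eq : ∀ s, m.generatorFun g s = F * g s

theorem IsEigenfunction.add_le_semigroup {g₁ g₂ : m.State → ℝ} {F₁ F₂ : ℝ}
    (hg₁ : IsEigenfunction g₁ F₁) (hg₂ : IsEigenfunction g₂ F₂) {a b : ℝ} {f : m.State →ᵇ ℝ}
    (hf : ∀ s, a * g₁ s + b * g₂ s ≤ f s) (t : ℝ≥0) (s : m.State) :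
    a * (Real.exp (t * F₁) * g₁ s) + b * (Real.exp (t * F₂) * g₂ s) ≤ m.semigroup t f s := by
  set c := m.totalRate
  have hle := le_pow_generator_add_totalRate
    (g := fun n s => a * (F₁ + c) ^ n * g₁ s + b * (F₂ + c) ^ n * g₂ s)
    (fun n => hg₁.diffusionSummable.add_smul hg₂.diffusionSummable _ _)
    (fun n s => by
      rw [generatorFun_add_smul hg₁.diffusionSummable hg₂.diffusionSummable,
        hg₁.generatorFun_eq, hg₂.generatorFun_eq]
      ring) (f := f) (fun s => by simpa using hf s)
  refine hasSum_le (fun n => ?_)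
    ((((hasSum_exp_shift t c F₁).mul_right (g₁ s)).mul_left a).add
      (((hasSum_exp_shift t c F₂).mul_right (g₂ s)).mul_left b))
    (hasSum_expSemigroup m.generator c t f (BoundedContinuousFunction.evalCLM ℝ s))
  have hweight : 0 ≤ Real.exp (-(t * c)) * ((n.factorial : ℝ)⁻¹ * (t : ℝ) ^ n) := by positivity
  calc _ = Real.exp (-(t * c)) * ((n.factorial : ℝ)⁻¹ * (t : ℝ) ^ n) *
        (a * (F₁ + c) ^ n * g₁ s + b * (F₂ + c) ^ n * g₂ s) := by ring
    _ ≤ _ := mul_le_mul_of_nonneg_left (hle n s) hweight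
    _ = _ := mul_assoc _ _ _

end Generator

section MomentGeneratingFunction

variable {d : ℕ} {m : ActiveParticleModel d} {Ω : Type*} [MeasurableSpace Ω] {P : Measure Ω}
  {X : ℝ≥0 → Ω → IntLattice d} {v : ℝ≥0 → Ω → m.V} {g g₁ g₂ : m.State → ℝ} {F F₁ F₂ : ℝ}

theorem IsActiveParticle.measurable_comp (h : m.IsActiveParticle P X v) (t : ℝ≥0)
    (f : m.State → ℝ) : Measurable fun ω => f (X t ω, v t ω) :=
  (measurable_of_countable f).comp ((h.measurable_pos t).prodMk (h.measurable_vel t))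

variable [IsFiniteMeasure P]

theorem IsActiveParticle.integrable_comp (h : m.IsActiveParticle P X v) (t : ℝ≥0)
    (f : m.State →ᵇ ℝ) : Integrable (fun ω => f (X t ω, v t ω)) P :=
  Integrable.of_bound (h.measurable_comp t f).aestronglyMeasurable ‖f‖
    (Eventually.of_forall fun _ => f.norm_coe_le_norm _)

theorem IsActiveParticle.integrable_initial (h : m.IsActiveParticle P X v) (f : m.V → ℝ) :
    Integrable (fun ω => f (v 0 ω)) P :=
  Integrable.of_bound ((measurable_of_countable f).comp (h.measurable_vel 0)).aestronglyMeasurable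
    ‖f‖ (Eventually.of_forall fun _ => norm_le_pi_norm f _)

theorem IsActiveParticle.integral_comp (h : m.IsActiveParticle P X v) (t : ℝ≥0)
    (f : m.State →ᵇ ℝ) :
    ∫ ω, f (X t ω, v t ω) ∂P = ∫ ω, m.semigroup t f (0, v 0 ω) ∂P := by
  have hm : (⨆ r ∈ Set.Iic (0 : ℝ≥0), MeasurableSpace.comap (fun ω => (X r ω, v r ω))
      inferInstance) ≤ (inferInstance : MeasurableSpace Ω) :=
    iSup₂_le fun r _ => ((h.measurable_pos r).prodMk (h.measurable_vel r)).comap_le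
  have hcond := integral_condExp (μ := P) hm (f := fun ω => f (X (0 + t) ω, v (0 + t) ω))
  rw [integral_congr_ae (h.markov 0 t f), zero_add] at hcond
  rw [← hcond]
  refine integral_congr_ae ?_
  filter_upwards [h.start] with ω hω
  rw [hω]

theorem IsActiveParticle.add_le_integral (h : m.IsActiveParticle P X v)
    (hg₁ : IsEigenfunction g₁ F₁) (hg₂ : IsEigenfunction g₂ F₂) {a b : ℝ} {f : m.State →ᵇ ℝ}
    (hf : ∀ s, a * g₁ s + b * g₂ s ≤ f s) (t : ℝ≥0) :
    a * (Real.exp (t * F₁) * ∫ ω, g₁ (0, v 0 ω) ∂P) +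
      b * (Real.exp (t * F₂) * ∫ ω, g₂ (0, v 0 ω) ∂P) ≤ ∫ ω, f (X t ω, v t ω) ∂P := by
  have hint₁ := ((h.integrable_initial fun w => g₁ (0, w)).const_mul
    (Real.exp (t * F₁))).const_mul a
  have hint₂ := ((h.integrable_initial fun w => g₂ (0, w)).const_mul
    (Real.exp (t * F₂))).const_mul b
  rw [h.integral_comp]
  simp only [← integral_const_mul]
  rw [← integral_add hint₁ hint₂]
  exact integral_mono (hint₁.add hint₂) (h.integrable_initial fun w => m.semigroup t f (0, w))
    fun ω => hg₁.add_le_semigroup hg₂ hf t (0, v 0 ω)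

theorem IsActiveParticle.integral_min_le (h : m.IsActiveParticle P X v)
    (hg : IsEigenfunction g F) (hg0 : ∀ s, 0 ≤ g s) (t : ℝ≥0) (n : ℕ) :
    ∫ ω, min (g (X t ω, v t ω)) n ∂P ≤ Real.exp (t * F) * ∫ ω, g (0, v 0 ω) ∂P := by
  let f : m.State →ᵇ ℝ := BoundedContinuousFunction.ofNormedAddCommGroupDiscrete
    (fun s => -min (g s) n) n fun s => by
      rw [norm_neg, Real.norm_of_nonneg (le_min (hg0 s) n.cast_nonneg)]
      exact min_le_right _ _
  have hle := h.add_le_integral hg hg (a := -1) (b := 0) (f := f)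
    (fun s => by simp only [zero_mul, add_zero, neg_one_mul]; exact neg_le_neg (min_le_left _ _)) t
  have hneg : ∫ ω, f (X t ω, v t ω) ∂P = -∫ ω, min (g (X t ω, v t ω)) n ∂P := integral_neg _
  rw [hneg] at hle
  linarith

theorem IsActiveParticle.integrable_eigenfunction (h : m.IsActiveParticle P X v)
    (hg : IsEigenfunction g F) (hg0 : ∀ s, 0 ≤ g s) (t : ℝ≥0) :
    Integrable (fun ω => g (X t ω, v t ω)) P ∧
      ∫ ω, g (X t ω, v t ω) ∂P ≤ Real.exp (t * F) * ∫ ω, g (0, v 0 ω) ∂P :=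
  integrable_and_integral_le_of_integral_min_le (h.measurable_comp t g) (fun _ => hg0 _)
    (h.integral_min_le hg hg0 t)

/-- An unbounded eigenfunction `g` is approximated from below by the bounded functions
`max (g - ε * g₂) 0`, which the quadratic growth of `g₂` in `g` keeps below `1 / (4 * ε * c)`. -/
theorem IsActiveParticle.integral_eigenfunction (h : m.IsActiveParticle P X v)
    (hg : IsEigenfunction g F) (hg0 : ∀ s, 0 ≤ g s) (hg₂ : IsEigenfunction g₂ F₂) {c : ℝ}
    (hc : 0 < c) (hsq : ∀ s, c * g s ^ 2 ≤ g₂ s) (t : ℝ≥0) :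
    ∫ ω, g (X t ω, v t ω) ∂P = Real.exp (t * F) * ∫ ω, g (0, v 0 ω) ∂P := by
  obtain ⟨hint, hle⟩ := h.integrable_eigenfunction hg hg0 t
  refine le_antisymm hle ?_
  have hbound : ∀ ε > 0, Real.exp (t * F) * ∫ ω, g (0, v 0 ω) ∂P -
      ε * (Real.exp (t * F₂) * ∫ ω, g₂ (0, v 0 ω) ∂P) ≤ ∫ ω, g (X t ω, v t ω) ∂P := by
    intro ε hε
    have htrunc : ∀ s, g s - ε * g₂ s ≤ 1 / (4 * (ε * c)) := fun s => by
      rw [le_div_iff₀ (by positivity)]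
      nlinarith [mul_le_mul_of_nonneg_left (hsq s) (by positivity : (0 : ℝ) ≤ 4 * ε ^ 2 * c),
        sq_nonneg (2 * (ε * c) * g s - 1)]
    let f : m.State →ᵇ ℝ := BoundedContinuousFunction.ofNormedAddCommGroupDiscrete
      (fun s => max (g s - ε * g₂ s) 0) (1 / (4 * (ε * c))) fun s => by
        rw [Real.norm_of_nonneg (le_max_right _ _)]
        exact max_le (htrunc s) (by positivity)
    have hf : ∀ s, f s ≤ g s := fun s => max_le
      (by nlinarith [(mul_nonneg hc.le (sq_nonneg (g s))).trans (hsq s)]) (hg0 s)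
    have hlow := h.add_le_integral hg hg₂ (a := 1) (b := -ε) (f := f)
      (fun s => by rw [one_mul, neg_mul, ← sub_eq_add_neg]; exact le_max_left _ _) t
    linarith [integral_mono (h.integrable_comp t f) hint fun ω => hf _]
  have hlim : Tendsto (fun ε : ℝ => Real.exp (t * F) * ∫ ω, g (0, v 0 ω) ∂P -
      ε * (Real.exp (t * F₂) * ∫ ω, g₂ (0, v 0 ω) ∂P)) (𝓝[>] 0)
      (𝓝 (Real.exp (t * F) * ∫ ω, g (0, v 0 ω) ∂P)) := by
    refine tendsto_nhdsWithin_of_tendsto_nhds (Continuous.tendsto' (by fun_prop) _ _ (by simp))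
  exact le_of_tendsto hlim (eventually_mem_nhdsWithin.mono hbound)

end MomentGeneratingFunction

end ActiveParticleModel

theorem tendsto_inv_mul_of_abs_sub_le {u : ℝ≥0 → ℝ} {F K : ℝ} (h : ∀ t : ℝ≥0, |u t - t * F| ≤ K) :
    Tendsto (fun t : ℝ≥0 => (t : ℝ)⁻¹ * u t) atTop (𝓝 F) := by
  have hinv : Tendsto (fun t : ℝ≥0 => (t : ℝ)⁻¹ * K) atTop (𝓝 0) := by
    simpa using (tendsto_inv_atTop_zero.comp (NNReal.tendsto_coe_atTop.2 tendsto_id)).mul_const K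
  refine tendsto_iff_dist_tendsto_zero.2 (squeeze_zero' (Eventually.of_forall fun _ => dist_nonneg)
    ?_ hinv)
  filter_upwards [eventually_gt_atTop 0] with t ht
  have ht' : (0 : ℝ) < t := ht
  rw [Real.dist_eq, show (t : ℝ)⁻¹ * u t - F = (t : ℝ)⁻¹ * (u t - t * F) by field_simp, abs_mul,
    abs_of_pos (inv_pos.2 ht')]
  exact mul_le_mul_of_nonneg_left (h t) (inv_pos.2 ht').le

namespace ActiveParticleModel

section ExponentialMoments

variable {d : ℕ} {m : ActiveParticleModel d}

/-- The function `(x, v) ↦ exp ⟨α, x⟩ r(v)`, an eigenfunction of the generator when `r` is an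
eigenvector of `M(α)`. -/
noncomputable def expFun (α : EuclideanSpace ℝ (Fin d)) (r : m.V → ℝ) (s : m.State) : ℝ :=
  Real.exp (inner ℝ α (latticeVec s.1)) * r s.2

theorem expFun_zero_left (α : EuclideanSpace ℝ (Fin d)) (r : m.V → ℝ) (w : m.V) :
    expFun α r (0, w) = r w := by
  simp [expFun, latticeVec_zero]

theorem expFun_add (α : EuclideanSpace ℝ (Fin d)) (r : m.V → ℝ) (x z : IntLattice d) (w : m.V) :
    expFun α r (x + z, w) = Real.exp (inner ℝ α (latticeVec z)) * expFun α r (x, w) := by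
  simp only [expFun, latticeVec_add, inner_add_right, Real.exp_add]
  ring

variable (m) in
theorem hasSum_jumpCumulant (α : EuclideanSpace ℝ (Fin d)) :
    HasSum (fun z : IntLattice d => m.p z * (Real.exp (inner ℝ α (latticeVec z)) - 1))
      (m.jumpCumulant α) :=
  (((m.p_exp α).sub m.p_hasSum.summable).congr fun z => by ring).hasSum

theorem hasSum_diffusion_expFun (α : EuclideanSpace ℝ (Fin d)) (r : m.V → ℝ) (s : m.State) :
    HasSum (fun z => m.p z * (expFun α r (s.1 + z, s.2) - expFun α r s))
      (m.jumpCumulant α * expFun α r s) :=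
  ((m.hasSum_jumpCumulant α).mul_right _).congr_fun fun z => by
    rw [expFun_add]
    ring

theorem flipGen_expFun (α : EuclideanSpace ℝ (Fin d)) (r : m.V → ℝ) (s : m.State) :
    m.flipGen (fun v => expFun α r (s.1, v)) s.2 =
      Real.exp (inner ℝ α (latticeVec s.1)) * m.flipGen r s.2 := by
  simp only [flipGen, expFun, Finset.mul_sum]
  exact Finset.sum_congr rfl fun v _ => by ring

theorem isEigenfunction_expFun {α : EuclideanSpace ℝ (Fin d)} {r : m.V → ℝ} {F : ℝ}
    (hr : (m.tiltedMatrix α).mulVec r = F • r) : IsEigenfunction (expFun α r) F where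
  diffusionSummable s := (hasSum_diffusion_expFun α r s).summable
  generatorFun_eq s := by
    have heigen := congrFun hr s.2
    simp only [tiltedMatrix, Matrix.add_mulVec, Matrix.smul_mulVec, flipMatrix_mulVec,
      Pi.add_apply, Pi.smul_apply, smul_eq_mul, Matrix.mulVec_diagonal, potential] at heigen
    have htransport : m.transport (expFun α r) s =
        (Real.exp (inner ℝ α (latticeVec (s.2 : IntLattice d))) - 1) * expFun α r s := by
      rw [transport, expFun_add]
      ring
    have hdiffusion : m.diffusion (expFun α r) s = m.jumpCumulant α * expFun α r s :=
      (hasSum_diffusion_expFun α r s).tsum_eq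
    rw [generatorFun, htransport, hdiffusion, flipGen_expFun, expFun]
    linear_combination Real.exp (inner ℝ α (latticeVec s.1)) * heigen

theorem mul_expFun_sq_le {α : EuclideanSpace ℝ (Fin d)} {r r₂ : m.V → ℝ} {c : ℝ}
    (hc : c • r ^ 2 ≤ r₂) (s : m.State) :
    c * expFun α r s ^ 2 ≤ expFun ((2 : ℝ) • α) r₂ s := by
  have hexp : Real.exp (inner ℝ ((2 : ℝ) • α) (latticeVec s.1)) =
      Real.exp (inner ℝ α (latticeVec s.1)) ^ 2 := by
    rw [real_inner_smul_left, ← Real.exp_nat_mul]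
    norm_num
  calc c * expFun α r s ^ 2 = Real.exp (inner ℝ α (latticeVec s.1)) ^ 2 * (c • r ^ 2) s.2 := by
        simp only [expFun, Pi.smul_apply, Pi.pow_apply, smul_eq_mul]
        ring
    _ ≤ Real.exp (inner ℝ α (latticeVec s.1)) ^ 2 * r₂ s.2 :=
        mul_le_mul_of_nonneg_left (hc s.2) (by positivity)
    _ = expFun ((2 : ℝ) • α) r₂ s := by rw [expFun, hexp]

variable {Ω : Type*} [MeasurableSpace Ω] {P : Measure Ω}
  {X : ℝ≥0 → Ω → IntLattice d} {v : ℝ≥0 → Ω → m.V} {α : EuclideanSpace ℝ (Fin d)}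
  {r r₂ : m.V → ℝ} {F F₂ c C : ℝ}

theorem IsActiveParticle.integrable_expFun [IsFiniteMeasure P]
    (h : m.IsActiveParticle P X v) (hr : ∀ w, 0 ≤ r w)
    (hF : (m.tiltedMatrix α).mulVec r = F • r) (t : ℝ≥0) :
    Integrable (fun ω => expFun α r (X t ω, v t ω)) P :=
  (h.integrable_eigenfunction (isEigenfunction_expFun hF)
    (fun _ => mul_nonneg (Real.exp_pos _).le (hr _)) t).1

theorem IsActiveParticle.integral_expFun [IsProbabilityMeasure P]
    (h : m.IsActiveParticle P X v) (hr : ∀ w, 0 < r w)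
    (hF : (m.tiltedMatrix α).mulVec r = F • r) (hr₂ : ∀ w, 0 < r₂ w)
    (hF₂ : (m.tiltedMatrix ((2 : ℝ) • α)).mulVec r₂ = F₂ • r₂) (t : ℝ≥0) :
    ∫ ω, expFun α r (X t ω, v t ω) ∂P = Real.exp (t * F) * ∫ ω, r (v 0 ω) ∂P := by
  have : Nonempty m.V := (nonempty_of_isProbabilityMeasure P).map (v 0)
  obtain ⟨c, hc, hle⟩ := exists_pos_smul_le (y := r ^ 2) hr₂ fun w => pow_pos (hr w) 2
  have hmean := h.integral_eigenfunction (isEigenfunction_expFun hF)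
    (fun _ => mul_nonneg (Real.exp_pos _).le (hr _).le) (isEigenfunction_expFun hF₂) hc
    (mul_expFun_sq_le hle) t
  simpa only [expFun_zero_left] using hmean

theorem IsActiveParticle.integrable_exp_inner [IsFiniteMeasure P]
    (h : m.IsActiveParticle P X v) (hc : 0 < c)
    (hcr : ∀ w, c ≤ r w) (hF : (m.tiltedMatrix α).mulVec r = F • r) (t : ℝ≥0) :
    Integrable (fun ω => Real.exp (inner ℝ α (latticeVec (X t ω)))) P := by
  refine ((h.integrable_expFun (fun w => hc.le.trans (hcr w)) hF t).const_mul c⁻¹).mono'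
    (h.measurable_comp t fun s => Real.exp (inner ℝ α (latticeVec s.1))).aestronglyMeasurable
    (Eventually.of_forall fun ω => ?_)
  rw [Real.norm_of_nonneg (Real.exp_pos _).le, expFun, le_inv_mul_iff₀ hc, mul_comm]
  exact mul_le_mul_of_nonneg_left (hcr _) (Real.exp_pos _).le

theorem IsActiveParticle.integral_exp_inner_bounds [IsProbabilityMeasure P]
    (h : m.IsActiveParticle P X v) (hc : 0 < c)
    (hcr : ∀ w, c ≤ r w) (hrC : ∀ w, r w ≤ C) (hF : (m.tiltedMatrix α).mulVec r = F • r)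
    (hr₂ : ∀ w, 0 < r₂ w) (hF₂ : (m.tiltedMatrix ((2 : ℝ) • α)).mulVec r₂ = F₂ • r₂) (t : ℝ≥0) :
    Real.exp (t * F) * c ≤ C * ∫ ω, Real.exp (inner ℝ α (latticeVec (X t ω))) ∂P ∧
      c * ∫ ω, Real.exp (inner ℝ α (latticeVec (X t ω))) ∂P ≤ Real.exp (t * F) * C := by
  have hr : ∀ w, 0 < r w := fun w => hc.trans_le (hcr w)
  have hint := h.integrable_exp_inner hc hcr hF t
  have hexp := h.integrable_expFun (fun w => (hr w).le) hF t
  have hmean := h.integral_expFun hr hF hr₂ hF₂ t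
  have hc0 : c ≤ ∫ ω, r (v 0 ω) ∂P := by
    simpa using integral_mono (integrable_const c) (h.integrable_initial r) fun ω => hcr (v 0 ω)
  have hC0 : ∫ ω, r (v 0 ω) ∂P ≤ C := by
    simpa using integral_mono (h.integrable_initial r) (integrable_const C) fun ω => hrC (v 0 ω)
  rw [← integral_const_mul, ← integral_const_mul]
  constructor
  · refine (mul_le_mul_of_nonneg_left hc0 (Real.exp_pos _).le).trans (hmean.symm.trans_le ?_)
    refine integral_mono hexp (hint.const_mul C) fun ω => ?_
    exact (mul_le_mul_of_nonneg_left (hrC _) (Real.exp_pos _).le).trans_eq (mul_comm _ _)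
  · refine le_trans ?_ (hmean.trans_le (mul_le_mul_of_nonneg_left hC0 (Real.exp_pos _).le))
    refine integral_mono (hint.const_mul c) hexp fun ω => ?_
    exact (mul_comm _ _).trans_le (mul_le_mul_of_nonneg_left (hcr _) (Real.exp_pos _).le)

theorem IsActiveParticle.tendsto_inv_mul_log_integral_exp_inner [IsProbabilityMeasure P]
    (h : m.IsActiveParticle P X v)
    (hc : 0 < c) (hcr : ∀ w, c ≤ r w) (hF : (m.tiltedMatrix α).mulVec r = F • r)
    (hr₂ : ∀ w, 0 < r₂ w) (hF₂ : (m.tiltedMatrix ((2 : ℝ) • α)).mulVec r₂ = F₂ • r₂) :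
    Tendsto (fun t : ℝ≥0 =>
      (t : ℝ)⁻¹ * Real.log (∫ ω, Real.exp (inner ℝ α (latticeVec (X t ω))) ∂P)) atTop (𝓝 F) := by
  have hC : 0 < ‖r‖ + c := add_pos_of_nonneg_of_pos (norm_nonneg r) hc
  refine tendsto_inv_mul_of_abs_sub_le (K := Real.log (‖r‖ + c) - Real.log c) fun t => ?_
  obtain ⟨hlower, hupper⟩ := h.integral_exp_inner_bounds (C := ‖r‖ + c) hc hcr
    (fun w => (le_abs_self _).trans ((norm_le_pi_norm r w).trans (by linarith))) hF hr₂ hF₂ t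
  set E := ∫ ω, Real.exp (inner ℝ α (latticeVec (X t ω))) ∂P
  have hE : 0 < E := pos_of_mul_pos_right ((mul_pos (Real.exp_pos _) hc).trans_le hlower) hC.le
  have hlog : ∀ {a b x y : ℝ}, 0 < a → 0 < b → 0 < x → 0 < y → a * x ≤ b * y →
      Real.log a + Real.log x ≤ Real.log b + Real.log y := fun ha hb hx hy hle => by
    rw [← Real.log_mul ha.ne' hx.ne', ← Real.log_mul hb.ne' hy.ne']
    exact Real.log_le_log (mul_pos ha hx) hle
  have hlog_lower := hlog (Real.exp_pos _) hC hc hE hlower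
  have hlog_upper := hlog hc (Real.exp_pos _) hE hC hupper
  rw [Real.log_exp] at hlog_lower hlog_upper
  rw [abs_le]
  constructor <;> linarith

end ExponentialMoments

end ActiveParticleModel

theorem exp_mul_mul_abs_le {s : ℝ} (hs : |s| ≤ 1) (y : ℝ) :
    Real.exp (s * y) * |y| ≤ Real.exp (2 * y) + Real.exp (-2 * y) := by
  have hsy : s * y ≤ |y| := (le_abs_self _).trans <| by
    rw [abs_mul]
    exact mul_le_of_le_one_left (abs_nonneg y) hs
  have hy : |y| ≤ Real.exp |y| := (le_add_of_nonneg_right zero_le_one).trans (Real.add_one_le_exp _)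
  calc Real.exp (s * y) * |y| ≤ Real.exp |y| * Real.exp |y| := by gcongr
    _ = Real.exp (2 * |y|) := by rw [← Real.exp_add, two_mul]
    _ ≤ Real.exp (2 * y) + Real.exp (-2 * y) := by
        rcases abs_choice y with h | h <;> rw [h]
        · exact le_add_of_nonneg_right (Real.exp_pos _).le
        · rw [mul_neg, ← neg_mul]
          exact le_add_of_nonneg_left (Real.exp_pos _).le

namespace ActiveParticleModel

section TiltedMatrix

variable {d : ℕ} (m : ActiveParticleModel d)

theorem differentiableAt_jumpCumulant (α β : EuclideanSpace ℝ (Fin d)) :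
    DifferentiableAt ℝ (fun s : ℝ => m.jumpCumulant (α + s • β)) 0 := by
  have hderiv := hasDerivAt_tsum_of_isPreconnected (t := Set.Ioo (-1 : ℝ) 1)
    ((m.p_exp (α + (2 : ℝ) • β)).add (m.p_exp (α + (-2 : ℝ) • β))) isOpen_Ioo isPreconnected_Ioo
    (g := fun z s => m.p z * (Real.exp (inner ℝ (α + s • β) (latticeVec z)) - 1))
    (g' := fun z s => m.p z * (Real.exp (inner ℝ (α + s • β) (latticeVec z)) *
      inner ℝ β (latticeVec z))) (y₀ := 0) (y := 0)
    (fun z s _ => by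
      have hinner : HasDerivAt (fun s : ℝ => inner ℝ (α + s • β) (latticeVec z))
          (inner ℝ β (latticeVec z)) s := by
        simp only [inner_add_left, real_inner_smul_left]
        simpa using ((hasDerivAt_id s).mul_const (inner ℝ β (latticeVec z))).const_add
          (inner ℝ α (latticeVec z))
      exact (hinner.exp.sub_const 1).const_mul (m.p z))
    (fun z s hs => by
      have hexp := exp_mul_mul_abs_le (abs_le.2 ⟨hs.1.le, hs.2.le⟩) (inner ℝ β (latticeVec z))
      rw [norm_mul, norm_mul, Real.norm_of_nonneg (m.p_nonneg z),
        Real.norm_of_nonneg (Real.exp_pos _).le, Real.norm_eq_abs, ← add_mul,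
        mul_comm (m.p z)]
      refine mul_le_mul_of_nonneg_right ?_ (m.p_nonneg z)
      simp only [inner_add_left, real_inner_smul_left, Real.exp_add, mul_assoc, ← mul_add]
      exact mul_le_mul_of_nonneg_left hexp (Real.exp_pos _).le)
    (by simp) (m.hasSum_jumpCumulant _).summable (by simp)
  exact hderiv.differentiableAt

theorem differentiableAt_potential (α β : EuclideanSpace ℝ (Fin d)) (w : m.V) :
    DifferentiableAt ℝ (fun s : ℝ => m.potential (α + s • β) w) 0 := by
  unfold potential
  have hjump := m.differentiableAt_jumpCumulant α β
  simp only [inner_add_left, real_inner_smul_left]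
  fun_prop

theorem differentiableAt_tiltedMatrix (α β : EuclideanSpace ℝ (Fin d)) (w w' : m.V) :
    DifferentiableAt ℝ (fun s : ℝ => m.tiltedMatrix (α + s • β) w w') 0 := by
  simp only [tiltedMatrix, Matrix.add_apply, Matrix.diagonal_apply]
  split_ifs
  · exact (m.differentiableAt_potential α β w).const_add _
  · exact differentiableAt_const _

theorem isMetzlerIrreducible_flipMatrix : IsMetzlerIrreducible m.flipMatrix where
  offDiag_nonneg w w' h := by
    rw [flipMatrix, if_neg h]
    exact m.flip_nonneg w w' h
  irreducible w w' := by
    refine Relation.ReflTransGen.mono (fun a b hab => ⟨hab.1, ?_⟩) _ _ (m.flip_irreducible w w')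
    rw [flipMatrix, if_neg hab.1]
    exact hab.2

theorem isMetzlerIrreducible_tiltedMatrix (α : EuclideanSpace ℝ (Fin d)) :
    IsMetzlerIrreducible (m.tiltedMatrix α) :=
  (m.isMetzlerIrreducible_flipMatrix.smul m.gam_pos).add_diagonal _

end TiltedMatrix

end ActiveParticleModel

section GrowthRates

variable {u : ℝ≥0 → ℝ} {F a : ℝ}

theorem eventually_le_exp_mul (hu : ∀ t, 0 < u t)
    (h : Tendsto (fun t : ℝ≥0 => (t : ℝ)⁻¹ * Real.log (u t)) atTop (𝓝 F)) (ha : F < a) :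
    ∀ᶠ t : ℝ≥0 in atTop, u t ≤ Real.exp (t * a) := by
  filter_upwards [h.eventually_le_const ha, eventually_gt_atTop 0] with t hle ht
  rwa [inv_mul_le_iff₀ (NNReal.coe_pos.2 ht), Real.log_le_iff_le_exp (hu t)] at hle

theorem eventually_exp_mul_le (hu : ∀ t, 0 < u t)
    (h : Tendsto (fun t : ℝ≥0 => (t : ℝ)⁻¹ * Real.log (u t)) atTop (𝓝 F)) (ha : a < F) :
    ∀ᶠ t : ℝ≥0 in atTop, Real.exp (t * a) ≤ u t := by
  filter_upwards [h.eventually_const_le ha, eventually_gt_atTop 0] with t hle ht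
  rwa [le_inv_mul_iff₀ (NNReal.coe_pos.2 ht), Real.le_log_iff_exp_le (hu t)] at hle

theorem tendsto_exp_neg_mul (ha : 0 < a) :
    Tendsto (fun t : ℝ≥0 => Real.exp (-(t * a))) atTop (𝓝 0) :=
  Real.tendsto_exp_neg_atTop_nhds_zero.comp
    ((NNReal.tendsto_coe_atTop.2 tendsto_id).atTop_mul_const ha)

theorem inv_mul_log_ofReal_exp {t : ℝ≥0} (ht : 0 < t) (a : ℝ) :
    (((t : ℝ)⁻¹ : ℝ) : EReal) * ENNReal.log (ENNReal.ofReal (Real.exp (t * a))) = (a : EReal) := by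
  rw [ENNReal.log_pos_real (ENNReal.ofReal_pos.2 (Real.exp_pos _)).ne' ENNReal.ofReal_ne_top,
    ENNReal.toReal_ofReal (Real.exp_pos _).le, Real.log_exp, ← EReal.coe_mul,
    inv_mul_cancel_left₀ (NNReal.coe_pos.2 ht).ne']

variable {Ω : Type*} [MeasurableSpace Ω] {P : Measure Ω} [IsFiniteMeasure P] {A : ℝ≥0 → Set Ω}

theorem limsup_inv_mul_log_measure_le
    (h : ∀ᶠ t : ℝ≥0 in atTop, P.real (A t) ≤ Real.exp (t * a)) :
    limsup (fun t : ℝ≥0 => (((t : ℝ)⁻¹ : ℝ) : EReal) * ENNReal.log (P (A t))) atTop ≤ a := by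
  refine limsup_le_of_le (by isBoundedDefault) ?_
  filter_upwards [h, eventually_gt_atTop 0] with t hle ht
  rw [← inv_mul_log_ofReal_exp ht a, ← ofReal_measureReal]
  exact mul_le_mul_of_nonneg_left (ENNReal.log_monotone (ENNReal.ofReal_le_ofReal hle))
    (EReal.coe_nonneg.2 (by positivity))

theorem le_liminf_inv_mul_log_measure
    (h : ∀ᶠ t : ℝ≥0 in atTop, Real.exp (t * a) ≤ P.real (A t)) :
    a ≤ liminf (fun t : ℝ≥0 => (((t : ℝ)⁻¹ : ℝ) : EReal) * ENNReal.log (P (A t))) atTop := by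
  refine le_liminf_of_le (by isBoundedDefault) ?_
  filter_upwards [h, eventually_gt_atTop 0] with t hle ht
  rw [← inv_mul_log_ofReal_exp ht a, ← ofReal_measureReal]
  exact mul_le_mul_of_nonneg_left (ENNReal.log_monotone (ENNReal.ofReal_le_ofReal hle))
    (EReal.coe_nonneg.2 (by positivity))

end GrowthRates

section ExponentialTilting

variable {Ω E : Type*} [MeasurableSpace Ω] [NormedAddCommGroup E] [InnerProductSpace ℝ E]

theorem measureReal_tilted_le {μ : Measure Ω} [IsFiniteMeasure μ] {f : Ω → ℝ} {s : Set Ω} {a : ℝ}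
    (hs : ∀ ω ∈ s, f ω ≤ a) :
    (μ.tilted f).real s ≤ Real.exp a / (∫ ω, Real.exp (f ω) ∂μ) * μ.real s := by
  have hI : 0 ≤ ∫ ω, Real.exp (f ω) ∂μ := integral_nonneg fun _ => (Real.exp_pos _).le
  have hle : μ.tilted f s ≤ ENNReal.ofReal (Real.exp a / ∫ ω, Real.exp (f ω) ∂μ) * μ s := by
    rw [tilted_apply, ← setLIntegral_const]
    exact setLIntegral_mono measurable_const fun ω hω => ENNReal.ofReal_le_ofReal
      (div_le_div_of_nonneg_right (Real.exp_le_exp.2 (hs ω hω)) hI)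
  have hreal := ENNReal.toReal_mono (ENNReal.mul_ne_top ENNReal.ofReal_ne_top
    (measure_ne_top μ s)) hle
  rwa [ENNReal.toReal_mul, ENNReal.toReal_ofReal (by positivity)] at hreal

theorem inner_le_of_inv_smul_mem_closedBall {α x y : E} {t ρ : ℝ} (ht : 0 < t)
    (h : t⁻¹ • x ∈ Metric.closedBall y ρ) : inner ℝ α x ≤ t * (inner ℝ α y + ‖α‖ * ρ) := by
  have hCS := (real_inner_le_norm α (t⁻¹ • x - y)).trans
    (mul_le_mul_of_nonneg_left (mem_closedBall_iff_norm.1 h) (norm_nonneg α))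
  rwa [inner_sub_right, real_inner_smul_right, sub_le_iff_le_add', inv_mul_le_iff₀ ht] at hCS

theorem measureReal_lt_inner_le {μ : Measure Ω} [IsFiniteMeasure μ] {Y : Ω → E} {α : E}
    (hint : Integrable (fun ω => Real.exp (inner ℝ α (Y ω))) μ) (b : ℝ) :
    μ.real {ω | b < inner ℝ α (Y ω)} ≤
      Real.exp (-b) * ∫ ω, Real.exp (inner ℝ α (Y ω)) ∂μ := by
  have hchernoff := ProbabilityTheory.measure_ge_le_exp_mul_mgf (μ := μ)
    (X := fun ω => inner ℝ α (Y ω)) (t := 1) b zero_le_one (by simpa using hint)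
  simp only [ProbabilityTheory.mgf, one_mul, neg_mul] at hchernoff
  exact (measureReal_mono fun ω (hω : b < _) => hω.le).trans hchernoff

theorem convexOn_log_integral_exp_inner {μ : Measure Ω} [NeZero μ] {Y : Ω → E}
    (hint : ∀ α, Integrable (fun ω => Real.exp (inner ℝ α (Y ω))) μ) :
    ConvexOn ℝ Set.univ fun α => Real.log (∫ ω, Real.exp (inner ℝ α (Y ω)) ∂μ) := by
  refine ⟨convex_univ, fun α _ β _ a b ha hb hab => ?_⟩
  set I : E → ℝ := fun α => ∫ ω, Real.exp (inner ℝ α (Y ω)) ∂μ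
  have hIpos : ∀ α, 0 < I α := fun α => integral_exp_pos (hint α)
  have hnormalized : ∀ α, Integrable (fun ω => Real.exp (inner ℝ α (Y ω) - Real.log (I α))) μ ∧
      ∫ ω, Real.exp (inner ℝ α (Y ω) - Real.log (I α)) ∂μ = 1 := fun α => by
    simp only [Real.exp_sub, Real.exp_log (hIpos α), integral_div]
    exact ⟨(hint α).div_const _, div_self (hIpos α).ne'⟩
  obtain ⟨hα, hα1⟩ := hnormalized α
  obtain ⟨hβ, hβ1⟩ := hnormalized β
  have hcombine : ∀ ω, inner ℝ (a • α + b • β) (Y ω) -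
      (a * Real.log (I α) + b * Real.log (I β)) = a * (inner ℝ α (Y ω) - Real.log (I α)) +
        b * (inner ℝ β (Y ω) - Real.log (I β)) := fun ω => by
    rw [inner_add_left, real_inner_smul_left, real_inner_smul_left]
    ring
  have hle : ∫ ω, Real.exp (inner ℝ (a • α + b • β) (Y ω) -
      (a * Real.log (I α) + b * Real.log (I β))) ∂μ ≤
        a * ∫ ω, Real.exp (inner ℝ α (Y ω) - Real.log (I α)) ∂μ +
        b * ∫ ω, Real.exp (inner ℝ β (Y ω) - Real.log (I β)) ∂μ := by
    rw [← integral_const_mul, ← integral_const_mul,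
      ← integral_add (hα.const_mul a) (hβ.const_mul b)]
    refine integral_mono ?_ ((hα.const_mul a).add (hβ.const_mul b)) fun ω => ?_
    · simpa only [Real.exp_sub] using (hint _).div_const _
    · rw [hcombine]
      exact convexOn_exp.2 (Set.mem_univ _) (Set.mem_univ _) ha hb hab
  rw [hα1, hβ1, mul_one, mul_one, hab] at hle
  simp only [Real.exp_sub, integral_div] at hle
  rw [div_le_one (Real.exp_pos _)] at hle
  exact (Real.log_le_iff_le_exp (hIpos _)).2 hle

end ExponentialTilting

theorem exists_pos_lt_mul_of_hasDerivAt {g : ℝ → ℝ} {a b : ℝ} (hg : HasDerivAt g a 0)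
    (hab : a < b) : ∃ s > 0, g s < g 0 + s * b := by
  have hslope : Tendsto (slope g 0) (𝓝[>] 0) (𝓝 a) :=
    (hasDerivAt_iff_tendsto_slope.1 hg).mono_left
      (nhdsWithin_mono _ fun _ hs => (Set.mem_Ioi.1 hs).ne')
  obtain ⟨s, hlt, hs⟩ := ((hslope.eventually_lt_const hab).and self_mem_nhdsWithin).exists
  replace hs : 0 < s := hs
  rw [slope_def_field, sub_zero, div_lt_iff₀ hs, sub_lt_iff_lt_add', mul_comm] at hlt
  exact ⟨s, hs, hlt⟩

/-- The random vectors `X t` have, under the laws `P t`, all exponential moments, and the limit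
`F α` of `t⁻¹ log E exp ⟨α, X t⟩` exists for all `α`. The law is allowed to depend on `t`, which
makes the notion stable under exponential tilting. -/
structure HasFreeEnergy {Ω E : Type*} [MeasurableSpace Ω] [NormedAddCommGroup E]
    [InnerProductSpace ℝ E] (P : ℝ≥0 → Measure Ω) (X : ℝ≥0 → Ω → E) (F : E → ℝ) : Prop where
  isProbabilityMeasure : ∀ t, IsProbabilityMeasure (P t)
  integrable_exp : ∀ t α, Integrable (fun ω => Real.exp (inner ℝ α (X t ω))) (P t)
  tendsto_log : ∀ α, Tendsto (fun t : ℝ≥0 =>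
    (t : ℝ)⁻¹ * Real.log (∫ ω, Real.exp (inner ℝ α (X t ω)) ∂P t)) atTop (𝓝 (F α))

namespace HasFreeEnergy

section HalfSpaceBounds

variable {Ω E : Type*} [MeasurableSpace Ω] [NormedAddCommGroup E] [InnerProductSpace ℝ E]
  {P : ℝ≥0 → Measure Ω} {X : ℝ≥0 → Ω → E} {F : E → ℝ}

theorem integral_exp_pos (h : HasFreeEnergy P X F) (t : ℝ≥0) (α : E) :
    0 < ∫ ω, Real.exp (inner ℝ α (X t ω)) ∂P t :=
  have := h.isProbabilityMeasure t
  MeasureTheory.integral_exp_pos (h.integrable_exp t α)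

theorem apply_zero (h : HasFreeEnergy P X F) : F 0 = 0 := by
  refine tendsto_nhds_unique (h.tendsto_log 0) (tendsto_const_nhds.congr fun t => ?_)
  have := h.isProbabilityMeasure t
  simp

theorem convexOn (h : HasFreeEnergy P X F) : ConvexOn ℝ Set.univ F := by
  refine ⟨convex_univ, fun α _ β _ a b ha hb hab => le_of_tendsto_of_tendsto'
    (h.tendsto_log (a • α + b • β)) (((h.tendsto_log α).const_mul a).add
      ((h.tendsto_log β).const_mul b)) fun t => ?_⟩
  have := h.isProbabilityMeasure t
  have hconvex := (convexOn_log_integral_exp_inner (h.integrable_exp t)).2 (Set.mem_univ α)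
    (Set.mem_univ β) ha hb hab
  refine (mul_le_mul_of_nonneg_left hconvex (inv_nonneg.2 t.coe_nonneg)).trans_eq ?_
  simp only [smul_eq_mul]
  ring

theorem tilted (h : HasFreeEnergy P X F) (α : E) :
    HasFreeEnergy (fun t => (P t).tilted fun ω => inner ℝ α (X t ω)) X
      (fun β => F (α + β) - F α) where
  isProbabilityMeasure t :=
    have := h.isProbabilityMeasure t
    isProbabilityMeasure_tilted (h.integrable_exp t α)
  integrable_exp t β := by
    rw [integrable_tilted_iff (h.integrable_exp t α)]
    simpa only [smul_eq_mul, ← Real.exp_add, ← inner_add_left] using h.integrable_exp t (α + β)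
  tendsto_log β := by
    refine ((h.tendsto_log (α + β)).sub (h.tendsto_log α)).congr fun t => ?_
    rw [integral_exp_tilted]
    simp only [Pi.add_apply, ← inner_add_left]
    rw [Real.log_div (h.integral_exp_pos t _).ne' (h.integral_exp_pos t _).ne', mul_sub]

theorem tendsto_exp_mul_measureReal_halfSpace (h : HasFreeEnergy P X F) (α : E) {c c' : ℝ}
    (hc : c < c') : Tendsto (fun t : ℝ≥0 => Real.exp (t * c) *
      (P t).real {ω | c' < inner ℝ α ((t : ℝ)⁻¹ • X t ω) - F α}) atTop (𝓝 0) := by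
  have hη : 0 < (c' - c) / 2 := half_pos (sub_pos.2 hc)
  refine squeeze_zero' (Eventually.of_forall fun t => by positivity) ?_ (tendsto_exp_neg_mul hη)
  filter_upwards [eventually_gt_atTop 0, eventually_le_exp_mul (fun t => h.integral_exp_pos t α)
    (h.tendsto_log α) (lt_add_of_pos_right (F α) hη)] with t ht hmoment
  have := h.isProbabilityMeasure t
  have hset : {ω | c' < inner ℝ α ((t : ℝ)⁻¹ • X t ω) - F α} =
      {ω | t * (c' + F α) < inner ℝ α (X t ω)} := by
    ext ω
    simp only [Set.mem_ofPred_eq]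
    rw [real_inner_smul_right, lt_sub_iff_add_lt, lt_inv_mul_iff₀ (NNReal.coe_pos.2 ht)]
  calc Real.exp (t * c) * (P t).real {ω | c' < inner ℝ α ((t : ℝ)⁻¹ • X t ω) - F α}
      ≤ Real.exp (t * c) * (Real.exp (-(t * (c' + F α))) *
          Real.exp (t * (F α + (c' - c) / 2))) := by
        rw [hset]
        gcongr
        exact (measureReal_lt_inner_le (h.integrable_exp t α) _).trans
          (mul_le_mul_of_nonneg_left hmoment (Real.exp_pos _).le)
    _ = Real.exp (-(t * ((c' - c) / 2))) := by
        rw [← Real.exp_add, ← Real.exp_add]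
        ring_nf

theorem tendsto_measureReal_lt_inner_sub (h : HasFreeEnergy P X F) {β y : E} {δ : ℝ} (hδ : 0 < δ)
    (hβ : HasDerivAt (fun s : ℝ => F (s • β)) (inner ℝ β y) 0) :
    Tendsto (fun t : ℝ≥0 => (P t).real {ω | δ < inner ℝ β ((t : ℝ)⁻¹ • X t ω - y)})
      atTop (𝓝 0) := by
  obtain ⟨s, hs, hFs⟩ := exists_pos_lt_mul_of_hasDerivAt hβ (lt_add_of_pos_right _ hδ)
  rw [zero_smul, h.apply_zero, zero_add] at hFs
  have hlim := h.tendsto_exp_mul_measureReal_halfSpace (s • β) (sub_pos.2 hFs)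
  simp only [mul_zero, Real.exp_zero, one_mul] at hlim
  refine squeeze_zero (fun t => measureReal_nonneg) (fun t => ?_) hlim
  have := h.isProbabilityMeasure t
  refine measureReal_mono fun ω (hω : δ < _) => ?_
  rw [inner_sub_right, lt_sub_iff_add_lt'] at hω
  simpa [real_inner_smul_left] using mul_lt_mul_of_pos_left hω hs

end HalfSpaceBounds

end HasFreeEnergy

section RegularisedMinimum

variable {E : Type*} [NormedAddCommGroup E] [InnerProductSpace ℝ E] {F : E → ℝ} {x α : E}
  {ε : ℝ}

theorem exists_forall_add_norm_sq_sub_inner_le [ProperSpace E] (hF : Continuous F) {K : ℝ}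
    (hK : ∀ α, inner ℝ α x - F α ≤ K) (hε : 0 < ε) :
    ∃ α, ∀ β, F α + ε / 2 * ‖α‖ ^ 2 - inner ℝ α x ≤ F β + ε / 2 * ‖β‖ ^ 2 - inner ℝ β x := by
  have hcoercive : Tendsto (fun α : E => ε / 2 * ‖α‖ ^ 2 + -K) (cocompact E) atTop :=
    tendsto_atTop_add_const_right _ _ (((tendsto_pow_atTop two_ne_zero).comp
      tendsto_norm_cocompact_atTop).const_mul_atTop (half_pos hε))
  refine Continuous.exists_forall_le (by fun_prop)
    (tendsto_atTop_mono (fun α => ?_) hcoercive)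
  linarith [hK α]

theorem hasDerivAt_of_forall_add_norm_sq_sub_inner_le
    (hα : ∀ β, F α + ε / 2 * ‖α‖ ^ 2 - inner ℝ α x ≤ F β + ε / 2 * ‖β‖ ^ 2 - inner ℝ β x) {β : E}
    (hdiff : DifferentiableAt ℝ (fun s : ℝ => F (α + s • β)) 0) :
    HasDerivAt (fun s : ℝ => F (α + s • β)) (inner ℝ β (x - ε • α)) 0 := by
  have hline : HasDerivAt (fun s : ℝ => α + s • β) β 0 := by
    simpa using ((hasDerivAt_id (0 : ℝ)).smul_const β).const_add α
  have hderiv := (hdiff.hasDerivAt.add (hline.norm_sq.const_mul (ε / 2))).sub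
    (hline.inner ℝ (hasDerivAt_const (0 : ℝ) x))
  have hmin : IsLocalMin (fun s : ℝ => F (α + s • β) + ε / 2 * ‖α + s • β‖ ^ 2 -
      inner ℝ (α + s • β) x) 0 :=
    Eventually.of_forall fun s => by simpa using hα (α + s • β)
  have hzero := hmin.hasDerivAt_eq_zero hderiv
  simp only [zero_smul, add_zero, inner_zero_right, zero_add] at hzero
  refine hdiff.hasDerivAt.congr_deriv ?_
  rw [inner_sub_right, real_inner_smul_right, real_inner_comm α β]
  linarith

/-- Points at which the Legendre transform is finite are approximated by gradients, namely at the
minimisers of the Legendre functional with a small quadratic penalty. -/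
theorem exists_hasDerivAt_dist_lt [ProperSpace E] (hF : Continuous F)
    (hdiff : ∀ α β, DifferentiableAt ℝ (fun s : ℝ => F (α + s • β)) 0) {K : ℝ}
    (hK : ∀ α, inner ℝ α x - F α ≤ K) {ρ : ℝ} (hρ : 0 < ρ) :
    ∃ α y : E, dist y x < ρ ∧ inner ℝ α y - F α ≤ K ∧
      ∀ β, HasDerivAt (fun s : ℝ => F (α + s • β)) (inner ℝ β y) 0 := by
  have hK0 : 0 ≤ K + F 0 := by simpa [neg_le_iff_add_nonneg] using hK 0
  set ε : ℝ := ρ ^ 2 / (4 * (K + F 0 + 1))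
  have hεpos : 0 < ε := by positivity
  obtain ⟨α, hα⟩ := exists_forall_add_norm_sq_sub_inner_le hF hK hεpos
  refine ⟨α, x - ε • α, ?_, ?_, fun β =>
    hasDerivAt_of_forall_add_norm_sq_sub_inner_le hα (hdiff α β)⟩
  · rw [dist_eq_norm, sub_sub_cancel_left, norm_neg, norm_smul, Real.norm_of_nonneg hεpos.le]
    have hα0 := hα 0
    simp only [norm_zero, inner_zero_left] at hα0
    have hnorm : ε * ‖α‖ ^ 2 ≤ 2 * (K + F 0) := by linarith [hK α]
    refine lt_of_pow_lt_pow_left₀ 2 hρ.le ?_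
    calc (ε * ‖α‖) ^ 2 = ε * (ε * ‖α‖ ^ 2) := by ring
      _ ≤ ε * (2 * (K + F 0)) := by gcongr
      _ < ε * (4 * (K + F 0 + 1)) := mul_lt_mul_of_pos_left (by linarith) hεpos
      _ = ρ ^ 2 := div_mul_cancel₀ _ (by positivity)
  · rw [inner_sub_right, real_inner_smul_right, real_inner_self_eq_norm_sq]
    have : 0 ≤ ε * ‖α‖ ^ 2 := by positivity
    linarith [hK α]

end RegularisedMinimum

/-- The positive and negative coordinate directions: finitely many linear functionals which control
the norm from one side. -/
noncomputable def axisDirection {d : ℕ} (j : Fin d × Bool) : EuclideanSpace ℝ (Fin d) :=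
  if j.2 then EuclideanSpace.single j.1 1 else -EuclideanSpace.single j.1 1

theorem norm_le_of_inner_axisDirection_le {d : ℕ} {z : EuclideanSpace ℝ (Fin d)} {δ : ℝ}
    (h : ∀ j, inner ℝ (axisDirection j) z ≤ δ) : ‖z‖ ≤ d * δ := by
  have hcoord : ∀ i, ‖z i‖ ≤ δ := by
    intro i
    have hpos := h (i, true)
    have hneg := h (i, false)
    simp only [axisDirection, if_true, inner_neg_left, EuclideanSpace.inner_single_left,
      Bool.false_eq_true, if_false, map_one, one_mul] at hpos hneg
    exact abs_le.2 ⟨neg_le.1 hneg, hpos⟩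
  calc ‖z‖ = ‖∑ i, z i • EuclideanSpace.single i (1 : ℝ)‖ := by
        congr 1
        ext k
        simp [Finset.sum_apply, Pi.single_apply]
    _ ≤ ∑ i, ‖z i • EuclideanSpace.single i (1 : ℝ)‖ := norm_sum_le _ _
    _ ≤ ∑ _i : Fin d, δ := Finset.sum_le_sum fun i _ => by
        rw [norm_smul, PiLp.norm_single, norm_one, mul_one]
        exact hcoord i
    _ = d * δ := by simp

section LegendreTransform

variable {d : ℕ} {F : EuclideanSpace ℝ (Fin d) → ℝ}

theorem legendreTransform_nonneg (h0 : F 0 = 0) (x : EuclideanSpace ℝ (Fin d)) :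
    0 ≤ legendreTransform F x :=
  le_iSup_of_le 0 (by simp [h0])

theorem legendreTransform_le_coe_iff {x : EuclideanSpace ℝ (Fin d)} {c : ℝ} :
    legendreTransform F x ≤ (c : EReal) ↔ ∀ α, inner ℝ α x - F α ≤ c := by
  simp only [legendreTransform, iSup_le_iff, EReal.coe_le_coe_iff]

theorem coe_lt_legendreTransform_iff {x : EuclideanSpace ℝ (Fin d)} {c : ℝ} :
    (c : EReal) < legendreTransform F x ↔ ∃ α, c < inner ℝ α x - F α := by
  simp only [legendreTransform, lt_iSup_iff, EReal.coe_lt_coe_iff]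

theorem lowerSemicontinuous_legendreTransform (F : EuclideanSpace ℝ (Fin d) → ℝ) :
    LowerSemicontinuous (legendreTransform F) :=
  lowerSemicontinuous_iSup fun _ =>
    (continuous_coe_real_ereal.comp (by fun_prop)).lowerSemicontinuous

theorem norm_le_of_inner_axisDirection_sub_le {x : EuclideanSpace ℝ (Fin d)} {c : ℝ}
    (h : ∀ j, inner ℝ (axisDirection j) x - F (axisDirection j) ≤ c) :
    ‖x‖ ≤ d * ∑ j : Fin d × Bool, |c + F (axisDirection j)| := by
  refine norm_le_of_inner_axisDirection_le fun j => (sub_le_iff_le_add.1 (h j)).trans ?_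
  exact (le_abs_self _).trans (Finset.single_le_sum
    (f := fun j => |c + F (axisDirection j)|) (fun _ _ => abs_nonneg _) (Finset.mem_univ j))

theorem isCompact_legendreTransform_le (F : EuclideanSpace ℝ (Fin d) → ℝ) (c : ℝ) :
    IsCompact {x | legendreTransform F x ≤ (c : EReal)} := by
  have hbounded : ∀ x ∈ {x | legendreTransform F x ≤ (c : EReal)}, x ∈ Metric.closedBall 0 _ :=
    fun x hx => mem_closedBall_zero_iff.2 (norm_le_of_inner_axisDirection_sub_le fun j =>
      legendreTransform_le_coe_iff.1 hx (axisDirection j))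
  exact (isCompact_closedBall _ _).of_isClosed_subset
    ((lowerSemicontinuous_legendreTransform F).isClosed_preimage (c : EReal)) hbounded

theorem exists_finset_halfSpace_cover {B : Set (EuclideanSpace ℝ (Fin d))} (hB : IsClosed B) {c : ℝ}
    (hc : ∀ x ∈ B, (c : EReal) < legendreTransform F x) :
    ∃ T : Finset (EuclideanSpace ℝ (Fin d)), ∀ x ∈ B, ∃ α ∈ T, c < inner ℝ α x - F α := by
  classical
  have hcompact := (isCompact_closedBall (0 : EuclideanSpace ℝ (Fin d))
    (d * ∑ j : Fin d × Bool, |c + F (axisDirection j)|)).inter_left hB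
  obtain ⟨T, hT⟩ := hcompact.elim_finite_subcover (fun α => {x | c < inner ℝ α x - F α})
    (fun α => isOpen_lt (by fun_prop) (by fun_prop))
    fun x hx => Set.mem_iUnion.2 (coe_lt_legendreTransform_iff.1 (hc x hx.1))
  refine ⟨T ∪ Finset.univ.image axisDirection, fun x hx => ?_⟩
  by_cases hfar : ∃ j, c < inner ℝ (axisDirection j) x - F (axisDirection j)
  · obtain ⟨j, hj⟩ := hfar
    exact ⟨_, Finset.mem_union_right _ (Finset.mem_image_of_mem _ (Finset.mem_univ j)), hj⟩
  · push Not at hfar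
    obtain ⟨α, hα, hx'⟩ := Set.mem_iUnion₂.1
      (hT ⟨hx, mem_closedBall_zero_iff.2 (norm_le_of_inner_axisDirection_sub_le hfar)⟩)
    exact ⟨α, Finset.mem_union_left _ hα, hx'⟩

end LegendreTransform

namespace HasFreeEnergy

section LargeDeviations

variable {d : ℕ} {Ω : Type*} [MeasurableSpace Ω] {P : ℝ≥0 → Measure Ω}
  {X : ℝ≥0 → Ω → EuclideanSpace ℝ (Fin d)} {F : EuclideanSpace ℝ (Fin d) → ℝ}

theorem eventually_measureReal_le_exp (h : HasFreeEnergy P X F)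
    {B : Set (EuclideanSpace ℝ (Fin d))} (hB : IsClosed B) {c c' : ℝ} (hcc' : c < c')
    (hc' : ∀ x ∈ B, (c' : EReal) < legendreTransform F x) :
    ∀ᶠ t : ℝ≥0 in atTop, (P t).real {ω | (t : ℝ)⁻¹ • X t ω ∈ B} ≤ Real.exp (t * -c) := by
  obtain ⟨T, hT⟩ := exists_finset_halfSpace_cover hB hc'
  have hlim := tendsto_finsetSum T fun α _ => h.tendsto_exp_mul_measureReal_halfSpace α hcc'
  rw [Finset.sum_const_zero] at hlim
  filter_upwards [hlim.eventually_le_const one_pos] with t ht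
  have := h.isProbabilityMeasure t
  refine le_of_mul_le_mul_left ?_ (Real.exp_pos (t * c))
  rw [← Real.exp_add, mul_neg, add_neg_cancel, Real.exp_zero]
  refine le_trans ?_ ht
  rw [← Finset.mul_sum]
  gcongr
  refine (measureReal_mono (fun ω hω => ?_) (measure_ne_top _ _)).trans
    (measureReal_biUnion_finset_le T _)
  obtain ⟨α, hα, hlt⟩ := hT _ hω
  exact Set.mem_iUnion₂.2 ⟨α, hα, hlt⟩

theorem tendsto_measureReal_notMem_closedBall (h : HasFreeEnergy P X F)
    {y : EuclideanSpace ℝ (Fin d)}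
    (hy : ∀ β, HasDerivAt (fun s : ℝ => F (s • β)) (inner ℝ β y) 0) {ρ : ℝ} (hρ : 0 < ρ) :
    Tendsto (fun t : ℝ≥0 => (P t).real {ω | (t : ℝ)⁻¹ • X t ω ∉ Metric.closedBall y ρ})
      atTop (𝓝 0) := by
  have hδ : 0 < ρ / (d + 1) := by positivity
  have hlim := tendsto_finsetSum Finset.univ fun j (_ : j ∈ Finset.univ) =>
    h.tendsto_measureReal_lt_inner_sub hδ (hy (axisDirection j))
  rw [Finset.sum_const_zero] at hlim
  refine squeeze_zero (fun t => measureReal_nonneg) (fun t => ?_) hlim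
  have := h.isProbabilityMeasure t
  refine (measureReal_mono (fun ω hω => ?_) (measure_ne_top _ _)).trans
    (measureReal_iUnion_fintype_le _)
  by_contra hnear
  simp only [Set.mem_iUnion, Set.mem_ofPred_eq, not_exists, not_lt] at hnear
  refine hω (mem_closedBall_iff_norm.2 ((norm_le_of_inner_axisDirection_le hnear).trans ?_))
  rw [mul_div_assoc', div_le_iff₀ (by positivity)]
  nlinarith

theorem eventually_exp_le_measureReal_closedBall (h : HasFreeEnergy P X F)
    {α y : EuclideanSpace ℝ (Fin d)}
    (hy : ∀ β, HasDerivAt (fun s : ℝ => F (α + s • β)) (inner ℝ β y) 0) {ρ a : ℝ} (hρ : 0 < ρ)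
    (ha : inner ℝ α y - F α + ‖α‖ * ρ < a) : ∀ᶠ t : ℝ≥0 in atTop,
      Real.exp (t * -a) ≤ (P t).real {ω | (t : ℝ)⁻¹ • X t ω ∈ Metric.closedBall y ρ} := by
  obtain ⟨η, hη, rfl⟩ : ∃ η > 0, a = inner ℝ α y - F α + ‖α‖ * ρ + 2 * η :=
    ⟨(a - (inner ℝ α y - F α + ‖α‖ * ρ)) / 2, half_pos (sub_pos.2 ha), by ring⟩
  filter_upwards [eventually_gt_atTop 0,
    ((h.tilted α).tendsto_measureReal_notMem_closedBall (fun β => (hy β).sub_const _)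
      hρ).eventually_le_const one_half_pos,
    eventually_exp_mul_le (fun t => h.integral_exp_pos t α) (h.tendsto_log α) (sub_lt_self _ hη),
    (tendsto_exp_neg_mul hη).eventually_le_const one_half_pos] with t ht hfar hmoment hsmall
  set D := {ω | (t : ℝ)⁻¹ • X t ω ∈ Metric.closedBall y ρ}
  have := h.isProbabilityMeasure t
  have := (h.tilted α).isProbabilityMeasure t
  have hnear : 1 / 2 ≤ ((P t).tilted fun ω => inner ℝ α (X t ω)).real D := by
    have hcover := measureReal_union_le (μ := (P t).tilted fun ω => inner ℝ α (X t ω)) D Dᶜ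
    rw [Set.union_compl_self, probReal_univ] at hcover
    have hfar' : ((P t).tilted fun ω => inner ℝ α (X t ω)).real Dᶜ ≤ 1 / 2 := hfar
    linarith
  have htilt := hnear.trans (measureReal_tilted_le fun ω hω =>
    inner_le_of_inv_smul_mem_closedBall (NNReal.coe_pos.2 ht) hω)
  rw [div_mul_eq_mul_div, le_div_iff₀ (h.integral_exp_pos t α)] at htilt
  refine le_of_mul_le_mul_left ?_ (Real.exp_pos (t * (inner ℝ α y + ‖α‖ * ρ)))
  calc Real.exp (t * (inner ℝ α y + ‖α‖ * ρ)) *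
        Real.exp (t * -(inner ℝ α y - F α + ‖α‖ * ρ + 2 * η))
      = Real.exp (-(t * η)) * Real.exp (t * (F α - η)) := by
        rw [← Real.exp_add, ← Real.exp_add]
        ring_nf
    _ ≤ 1 / 2 * ∫ ω, Real.exp (inner ℝ α (X t ω)) ∂P t := by gcongr
    _ ≤ Real.exp (t * (inner ℝ α y + ‖α‖ * ρ)) * (P t).real D := htilt

theorem limsup_inv_mul_log_le_neg_iInf {P : Measure Ω} (h : HasFreeEnergy (fun _ => P) X F)
    {B : Set (EuclideanSpace ℝ (Fin d))} (hB : IsClosed B) :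
    limsup (fun t : ℝ≥0 => (((t : ℝ)⁻¹ : ℝ) : EReal) *
        ENNReal.log (P {ω | (t : ℝ)⁻¹ • X t ω ∈ B})) atTop ≤
      -(⨅ x ∈ B, legendreTransform F x) := by
  have := h.isProbabilityMeasure 0
  rw [EReal.le_neg, ← EReal.ge_of_forall_gt_iff_ge]
  intro c hc
  obtain ⟨c', hcc', hc'⟩ := EReal.lt_iff_exists_real_btwn.1 hc
  rw [EReal.le_neg, ← EReal.coe_neg]
  exact limsup_inv_mul_log_measure_le (h.eventually_measureReal_le_exp hB
    (EReal.coe_lt_coe_iff.1 hcc') fun x hx => hc'.trans_le (iInf₂_le x hx))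

theorem neg_iInf_le_liminf_inv_mul_log {P : Measure Ω} (h : HasFreeEnergy (fun _ => P) X F)
    (hdiff : ∀ α β, DifferentiableAt ℝ (fun s : ℝ => F (α + s • β)) 0)
    {G : Set (EuclideanSpace ℝ (Fin d))} (hG : IsOpen G) :
    -(⨅ x ∈ G, legendreTransform F x) ≤
      liminf (fun t : ℝ≥0 => (((t : ℝ)⁻¹ : ℝ) : EReal) *
        ENNReal.log (P {ω | (t : ℝ)⁻¹ • X t ω ∈ G})) atTop := by
  have := h.isProbabilityMeasure 0
  have hF : Continuous F := continuousOn_univ.1 (h.convexOn.continuousOn isOpen_univ)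
  rw [EReal.neg_le]
  refine le_iInf₂ fun x hx => ?_
  rw [← EReal.le_of_forall_lt_iff_le]
  intro a ha
  obtain ⟨K, hxK, hKa⟩ := EReal.lt_iff_exists_real_btwn.1 ha
  rw [EReal.coe_lt_coe_iff] at hKa
  obtain ⟨ρ₀, hρ₀, hball⟩ := Metric.isOpen_iff.1 hG x hx
  obtain ⟨α, y, hyx, hyK, hy⟩ := exists_hasDerivAt_dist_lt hF hdiff
    (legendreTransform_le_coe_iff.1 hxK.le) hρ₀
  have hsmall : ∀ᶠ ρ in 𝓝[>] (0 : ℝ), ρ + dist y x < ρ₀ ∧ ‖α‖ * ρ < a - K := by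
    refine eventually_nhdsWithin_of_eventually_nhds (Eventually.and ?_ ?_)
    · exact ContinuousAt.eventually_lt (by fun_prop) (by fun_prop) (by simpa using hyx)
    · exact ContinuousAt.eventually_lt (by fun_prop) (by fun_prop) (by simpa using hKa)
  obtain ⟨ρ, ⟨hρball, hρα⟩, hρ⟩ := (hsmall.and self_mem_nhdsWithin).exists
  rw [EReal.neg_le, ← EReal.coe_neg]
  refine le_liminf_inv_mul_log_measure ?_
  filter_upwards [h.eventually_exp_le_measureReal_closedBall hy hρ
    (show inner ℝ α y - F α + ‖α‖ * ρ < a by linarith)] with t ht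
  exact ht.trans (measureReal_mono fun ω hω => hball (Metric.mem_ball.2
    ((dist_triangle _ y x).trans_lt ((add_le_add_left hω _).trans_lt hρball))))

theorem satisfiesLDP {P : Measure Ω} (h : HasFreeEnergy (fun _ => P) X F)
    (hdiff : ∀ α β, DifferentiableAt ℝ (fun s : ℝ => F (α + s • β)) 0) :
    SatisfiesLDP P (fun t ω => (t : ℝ)⁻¹ • X t ω) (legendreTransform F) where
  nonneg := legendreTransform_nonneg h.apply_zero
  lowerSemicontinuous := lowerSemicontinuous_legendreTransform F
  compact_sublevel := isCompact_legendreTransform_le F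
  upper_bound _ hB := h.limsup_inv_mul_log_le_neg_iInf hB
  lower_bound _ hG := h.neg_iInf_le_liminf_inv_mul_log hdiff hG

end LargeDeviations

end HasFreeEnergy

namespace ActiveParticleModel

section VariationalFormula

variable {d : ℕ} {m : ActiveParticleModel d} {α : EuclideanSpace ℝ (Fin d)} {F : ℝ} {r l : m.V → ℝ}
  {μ : m.V → ℝ}

theorem sum_tiltedMatrix_mulVec_div {f : m.V → ℝ} (hf : ∀ w, 0 < f w) :
    ∑ w, (m.tiltedMatrix α).mulVec f w / f w * μ w =
      ∑ w, m.potential α w * μ w + m.gam * ∑ w, m.flipGen f w / f w * μ w := by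
  rw [Finset.mul_sum, ← Finset.sum_add_distrib]
  refine Finset.sum_congr rfl fun w _ => ?_
  rw [tiltedMatrix, Matrix.add_mulVec, Matrix.smul_mulVec, flipMatrix_mulVec]
  simp only [Pi.add_apply, Pi.smul_apply, smul_eq_mul, Matrix.mulVec_diagonal]
  have := (hf w).ne'
  field_simp
  ring

theorem donskerVaradhanInf_tiltedMatrix (hμ : μ ∈ stdSimplex ℝ m.V) :
    donskerVaradhanInf (m.tiltedMatrix α) μ =
      ∑ w, m.potential α w * μ w - m.gam * m.donskerVaradhan μ := by
  have : Nonempty {f : m.V → ℝ // ∀ w, 0 < f w} := ⟨⟨1, fun _ => one_pos⟩⟩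
  have hbdd : BddBelow (Set.range fun f : {f : m.V → ℝ // ∀ w, 0 < f w} =>
      m.gam * ∑ w, m.flipGen f.1 w / f.1 w * μ w) := by
    obtain ⟨b, hb⟩ := m.bddBelow_donskerVaradhan μ hμ
    exact ⟨m.gam * b, Set.forall_mem_range.2 fun f =>
      mul_le_mul_of_nonneg_left (hb ⟨f, rfl⟩) m.gam_pos.le⟩
  rw [donskerVaradhan, mul_neg, sub_neg_eq_add, Real.mul_iInf_of_nonneg m.gam_pos.le,
    add_ciInf hbdd]
  exact iInf_congr fun f => sum_tiltedMatrix_mulVec_div f.2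

theorem sum_potential_mul (hμ : ∑ w, μ w = 1) :
    ∑ w, m.potential α w * μ w = m.kap * m.jumpCumulant α +
      ∑ w : m.V, m.lam * (Real.exp (inner ℝ α (latticeVec (w : IntLattice d))) - 1) * μ w := by
  simp only [potential, add_mul, Finset.sum_add_distrib, ← Finset.mul_sum, hμ, mul_one]

theorem sum_sqrt_mul_sqrt_mul_tiltedMatrix (hμ : ∀ w, 0 ≤ μ w) :
    ∑ w, ∑ w', √(μ w) * √(μ w') * m.tiltedMatrix α w w' = ∑ w, m.potential α w * μ w +
      m.gam * ∑ w, ∑ w', √(μ w) * √(μ w') * m.flipMatrix w w' := by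
  simp only [tiltedMatrix, Matrix.add_apply, Matrix.smul_apply, smul_eq_mul, mul_add,
    Finset.sum_add_distrib, Matrix.diagonal_apply, mul_ite, mul_zero, Finset.sum_ite_eq,
    Finset.mem_univ, if_true, Real.mul_self_sqrt (hμ _), mul_left_comm _ m.gam, Finset.mul_sum]
  rw [add_comm]
  simp only [mul_comm (μ _)]

theorem tiltedMatrix_symm (hsymm : ∀ w w', m.flip w w' = m.flip w' w) (w w' : m.V) :
    m.tiltedMatrix α w w' = m.tiltedMatrix α w' w := by
  rcases eq_or_ne w w' with rfl | hw
  · rfl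
  · simp only [tiltedMatrix, Matrix.add_apply, Matrix.smul_apply, flipMatrix, if_neg hw,
      if_neg hw.symm, Matrix.diagonal_apply_ne _ hw, Matrix.diagonal_apply_ne _ hw.symm, hsymm w w']

theorem isLUB_donskerVaradhan (h : IsPerronTriple (m.tiltedMatrix α) F r l) :
    IsLUB ((fun μ : m.V → ℝ =>
      ∑ w, m.potential α w * μ w - m.gam * m.donskerVaradhan μ) '' stdSimplex ℝ m.V) F := by
  have hgreatest :=
    h.isGreatest_donskerVaradhanInf (m.isMetzlerIrreducible_tiltedMatrix α).offDiag_nonneg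
  rw [Set.image_congr fun μ hμ => donskerVaradhanInf_tiltedMatrix hμ] at hgreatest
  exact hgreatest.isLUB

theorem isLUB_donskerVaradhan_sub (h : IsPerronTriple (m.tiltedMatrix α) F r l) :
    IsLUB ((fun μ : m.V → ℝ =>
      ∑ w : m.V, m.lam * (Real.exp (inner ℝ α (latticeVec (w : IntLattice d))) - 1) * μ w
        - m.gam * m.donskerVaradhan μ) '' stdSimplex ℝ m.V) (F - m.kap * m.jumpCumulant α) := by
  have hshift := (OrderIso.subRight (m.kap * m.jumpCumulant α)).isLUB_image'.2
    (isLUB_donskerVaradhan h)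
  rw [Set.image_image] at hshift
  refine (Set.image_congr fun μ hμ => ?_) ▸ hshift
  rw [OrderIso.subRight_apply, sum_potential_mul hμ.2]
  ring

theorem isLUB_sum_sqrt_mul_sqrt (h : IsPerronTriple (m.tiltedMatrix α) F r l)
    (hsymm : ∀ w w', m.flip w w' = m.flip w' w) :
    IsLUB ((fun μ : m.V → ℝ => ∑ w, m.potential α w * μ w
      + m.gam * ∑ w, ∑ w', √(μ w) * √(μ w') * m.flipMatrix w w') '' stdSimplex ℝ m.V) F := by
  have hgreatest := h.isGreatest_sum_sqrt_mul_sqrt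
    (m.isMetzlerIrreducible_tiltedMatrix α).offDiag_nonneg (tiltedMatrix_symm hsymm)
  rw [Set.image_congr fun μ hμ => sum_sqrt_mul_sqrt_mul_tiltedMatrix hμ.1] at hgreatest
  exact hgreatest.isLUB

end VariationalFormula

section FreeEnergy

variable {d : ℕ} {m : ActiveParticleModel d} {F : EuclideanSpace ℝ (Fin d) → ℝ}
  {r l : EuclideanSpace ℝ (Fin d) → m.V → ℝ}

theorem differentiableAt_of_isPerronTriple
    (h : ∀ α, IsPerronTriple (m.tiltedMatrix α) (F α) (r α) (l α))
    (α β : EuclideanSpace ℝ (Fin d)) : DifferentiableAt ℝ (fun s : ℝ => F (α + s • β)) 0 :=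
  IsPerronTriple.differentiableAt_eigenvalue (fun s => h (α + s • β))
    (m.isMetzlerIrreducible_tiltedMatrix _) (m.differentiableAt_tiltedMatrix α β)

theorem IsActiveParticle.hasFreeEnergy {Ω : Type*} [MeasurableSpace Ω] {P : Measure Ω}
    [IsProbabilityMeasure P] {X : ℝ≥0 → Ω → IntLattice d} {v : ℝ≥0 → Ω → m.V}
    (hXv : m.IsActiveParticle P X v)
    (h : ∀ α, IsPerronTriple (m.tiltedMatrix α) (F α) (r α) (l α)) :
    HasFreeEnergy (fun _ => P) (fun t ω => latticeVec (X t ω)) F := by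
  have : Nonempty m.V := (h 0).nonempty
  have hlower : ∀ α, ∃ c > 0, ∀ w, c ≤ r α w := fun α =>
    let ⟨w, hw⟩ := Finite.exists_min (r α)
    ⟨r α w, (h α).right_pos w, hw⟩
  choose c hc hcr using hlower
  exact ⟨fun _ => inferInstance,
    fun t α => hXv.integrable_exp_inner (hc α) (hcr α) (h α).mulVec_right t,
    fun α => hXv.tendsto_inv_mul_log_integral_exp_inner (hc α) (hcr α) (h α).mulVec_right
      (h ((2 : ℝ) • α)).right_pos (h ((2 : ℝ) • α)).mulVec_right⟩

end FreeEnergy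

end ActiveParticleModel

theorem mainTheorem2 {d : ℕ} (m : ActiveParticleModel d)
    {Ω : Type*} [MeasurableSpace Ω] (P : Measure Ω) [IsProbabilityMeasure P]
    (X : ℝ≥0 → Ω → IntLattice d) (v : ℝ≥0 → Ω → m.V) (hXv : m.IsActiveParticle P X v) :
    ∃ F : EuclideanSpace ℝ (Fin d) → ℝ,
      -- the free energy is well defined: finite exponential moments and existence of the limit
      (∀ α, (∀ t, Integrable (fun ω => Real.exp (inner ℝ α (latticeVec (X t ω)))) P) ∧
        Tendsto (fun t : ℝ≥0 =>
            (t : ℝ)⁻¹ * Real.log (∫ ω, Real.exp (inner ℝ α (latticeVec (X t ω))) ∂P))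
          atTop (𝓝 (F α))) ∧
      -- it is the largest eigenvalue of `M(α)`: a real eigenvalue, and no complex eigenvalue has
      -- a larger real part
      (∀ α, Module.End.HasEigenvalue (Matrix.toLin' (m.tiltedMatrix α)) (F α) ∧
        ∀ z : ℂ, Module.End.HasEigenvalue
            (Matrix.toLin' ((m.tiltedMatrix α).map (fun r : ℝ => (r : ℂ)))) z → z.re ≤ F α) ∧
      -- the variational formula, in its two forms
      (∀ α, IsLUB ((fun μ : m.V → ℝ =>
            ∑ w, m.potential α w * μ w - m.gam * m.donskerVaradhan μ) '' stdSimplex ℝ m.V)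
          (F α)) ∧
      (∀ α, IsLUB ((fun μ : m.V → ℝ =>
            ∑ w : m.V, m.lam * (Real.exp (inner ℝ α (latticeVec (w : IntLattice d))) - 1) * μ w
              - m.gam * m.donskerVaradhan μ) '' stdSimplex ℝ m.V)
          (F α - m.kap * m.jumpCumulant α)) ∧
      -- the symmetric case
      ((∀ w w', m.flip w w' = m.flip w' w) → ∀ α, IsLUB ((fun μ : m.V → ℝ =>
            ∑ w, m.potential α w * μ w
              + m.gam * ∑ w, ∑ w', √(μ w) * √(μ w') * m.flipMatrix w w') '' stdSimplex ℝ m.V)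
          (F α)) ∧
      -- the large deviation principle for `X_t / t`
      SatisfiesLDP P (fun t ω => (t : ℝ)⁻¹ • latticeVec (X t ω)) (legendreTransform F) := by
  have : Nonempty m.V := (nonempty_of_isProbabilityMeasure P).map (v 0)
  choose F r l h using fun α => (m.isMetzlerIrreducible_tiltedMatrix α).exists_isPerronTriple
  have hfree := hXv.hasFreeEnergy h
  exact ⟨F, fun α => ⟨fun t => hfree.integrable_exp t α, hfree.tendsto_log α⟩,
    fun α => ⟨(h α).hasEigenvalue, fun z hz =>
      (h α).re_le_of_hasEigenvalue (m.isMetzlerIrreducible_tiltedMatrix α).offDiag_nonneg hz⟩,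
    fun α => ActiveParticleModel.isLUB_donskerVaradhan (h α),
    fun α => ActiveParticleModel.isLUB_donskerVaradhan_sub (h α),
    fun hsymm α => ActiveParticleModel.isLUB_sum_sqrt_mul_sqrt (h α) hsymm,
    hfree.satisfiesLDP (ActiveParticleModel.differentiableAt_of_isPerronTriple h)⟩
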